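/- Let $k$ be a field and $A$ a finite dimensional Frobenius $k$-algebra, i.e. $A$ carries a non-degenerate bilinear form $\langle-,-\rangle\colon A\times A\to k$ with $\langle ab,c\rangle=\langle a,bc\rangle$ for all $a,b,c\in A$. Let $\nu$ be the Nakayama automorphism of $A$ with respect to this form, i.e. the algebra automorphism with $\langle a,b\rangle=\langle b,\nu(a)\rangle$ for all $a,b\in A$. Write $D=\operatorname{Hom}_k(-,k)$ and let $A^{\mathrm e}=A\otimes_k A^{\circ}$ be the enveloping algebra, so that $A$-bimodules are left $A^{\mathrm e}$-modules via $(a\otimes b^\circ)m=amb$ and right $A^{\mathrm e}$-modules via $m(a\otimes b^\circ)=bma$. For algebra automorphisms $\alpha,\beta$ of $A$, let ${}_{\alpha}M_{\beta}$ be the bimodule with underlying space $M$ and $a*m*b=\alpha(a)\,m\,\beta(b)$. A complete resolution of $A$ over $A^{\mathrm e}$ is a diagram $\mathbf T\xrightarrow{\vartheta}\mathbf P\xrightarrow{\varepsilon}A$, where $\mathbf T=(T_i)_{i\in\mathbb Z}$ is an exact complex of finitely generated projective $A^{\mathrm e}$-modules such that $\operatorname{Hom}_{A^{\mathrm e}}(\mathbf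 T,A^{\mathrm e})$ is exact, $\mathbf P\xrightarrow{\varepsilon}A$ is a resolution by finitely generated projective $A^{\mathrm e}$-modules, and $\vartheta$ is a chain map with $\vartheta_i$ an isomorphism for all sufficiently large $i$. For an $A$-bimodule $M$ and $n\in\mathbb Z$, put $$\widehat{H}^{n}(A,M)=H^{n}(\operatorname{Hom}_{A^{\mathrm e}}(\mathbf T,M)),\qquad \widehat{H}_{n}(A,M)=H_{n}(\mathbf T\otimes_{A^{\mathrm e}}M).$$ Then $A$ has a complete resolution over $A^{\mathrm e}$, and for every $i\in\mathbb Z$ there are isomorphisms of $k$-vector spaces $$\widehat{H}_{i}(A,A)\cong D\bigl(\widehat{H}_{-i-1}(A,A)\bigr)\qquad\text{and}\qquad \widehat{H}^{i}(A,A)\cong D\bigl(\widehat{H}^{-i-1}(A,{}_{1}A_{\nu^{2}})\bigr),$$ where each group may be computed with any complete resolution of $A$, the two sides of an isomorphism possibly with different ones. -/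

import Mathlib

open CategoryTheory TensorProduct MulOpposite
open scoped ModuleCat

universe u v

noncomputable section

namespace TateHochschild

/-! ### Complete resolutions over a `k`-algebra -/

/-- A complete resolution `T ⟶ P ⟶ M` of an `R`-module `M`, where `R` is an algebra over the
field `k`: an exact `ℤ`-indexed chain complex `T` of finitely generated projective `R`-modules
whose `R`-dual complex `Hom_R(T, R)` is exact, a projective resolution `P ⟶ M` by finitely
generated projective modules, and a chain map `θ : T ⟶ P` that is an isomorphism in all
sufficiently large degrees.

As `P` is zero in negative degrees, a chain map `T ⟶ P` is the same thing as a family of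
morphisms `θ n : T_n ⟶ P_n` for `n : ℕ` commuting with the differentials. -/
structure CompleteResolution (k : Type u) [Field k] {R : Type v} [Ring R] [Algebra k R]
    (M : ModuleCat.{v} R) where
  /-- the complex `T` -/
  T : ChainComplex (ModuleCat.{v} R) ℤ
  finite_T : ∀ n : ℤ, Module.Finite R (T.X n)
  projective_T : ∀ n : ℤ, Module.Projective R (T.X n)
  acyclic : T.Acyclic
  dual_acyclic : (T.linearYonedaObj k (ModuleCat.of R R)).Acyclic
  /-- the projective resolution `P ⟶ M` -/
  P : ProjectiveResolution M
  finite_P : ∀ n : ℕ, Module.Finite R (P.complex.X n)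
  /-- the components in non-negative degrees of the chain map `T ⟶ P` -/
  θ : ∀ n : ℕ, T.X (n : ℤ) ⟶ P.complex.X n
  comm : ∀ n : ℕ, θ (n + 1) ≫ P.complex.d (n + 1) n = T.d ((n + 1 : ℕ) : ℤ) (n : ℤ) ≫ θ n
  isIso_θ : ∃ n₀ : ℕ, ∀ n : ℕ, n₀ ≤ n → IsIso (θ n)

/-! ### Bimodules as modules over the enveloping algebra -/

section Bimodules

variable (k : Type u) [Field k] (A : Type v) [Ring A] [Algebra k A]

/-- The enveloping algebra `Aᵉ = A ⊗ Aᵒᵖ`. An `A`-bimodule (with `k` acting centrally) is a left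
`Aᵉ`-module through `(a ⊗ b) • m = a m b`. -/
abbrev Env : Type v := A ⊗[k] Aᵐᵒᵖ

/-- `A` as a left module over its enveloping algebra: `(a ⊗ b) • x = a x b`. -/
def regular : ModuleCat.{v} (Env k A) :=
  letI : Module (Env k A) A := TensorProduct.Algebra.module
  ModuleCat.of (Env k A) A

variable {k A}

theorem regular_smul (a b x : A) :
    HSMul.hSMul (β := regular k A) (γ := regular k A) (a ⊗ₜ[k] op b : Env k A) x = a * x * b := by
  have h : TensorProduct.Algebra.moduleAux (R := k) (a ⊗ₜ[k] op b) x = a * x * b := by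
    simp [TensorProduct.Algebra.moduleAux, mul_assoc]
  exact h

/-- The twisted bimodule `_α M _β`: the same `k`-module as `M`, with `A`-bimodule structure
`a * m * b = α(a) m β(b)`. -/
def twist (α β : A ≃ₐ[k] A) (M : ModuleCat.{v} (Env k A)) : ModuleCat.{v} (Env k A) :=
  (ModuleCat.restrictScalars
    (Algebra.TensorProduct.map (α : A →ₐ[k] A)
      (AlgHom.op (β : A →ₐ[k] A))).toRingHom).obj M

theorem twist_smul (α β : A ≃ₐ[k] A) (M : ModuleCat.{v} (Env k A)) (a b : A) (m : M) :
    HSMul.hSMul (β := twist α β M) (γ := twist α β M) (a ⊗ₜ[k] op b : Env k A) m =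
      (α a ⊗ₜ[k] op (β b) : Env k A) • m :=
  rfl

/-! ### The tensor product over the enveloping algebra -/

/-- The relations `(b x a) ⊗ m = x ⊗ (a m b)` that cut `X ⊗_{Aᵉ} M` out of `X ⊗_k M`. Here the
bimodule `X` is regarded as a right `Aᵉ`-module through `x (a ⊗ b) = b x a`. -/
def balanced (X M : ModuleCat.{v} (Env k A)) : Submodule k (X ⊗[k] M) :=
  Submodule.span k
    {z | ∃ (a b : A) (x : X) (m : M),
      z = ((b ⊗ₜ[k] op a : Env k A) • x) ⊗ₜ[k] m - x ⊗ₜ[k] ((a ⊗ₜ[k] op b : Env k A) • m)}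

/-- The functor `X ↦ X ⊗_{Aᵉ} M` from `A`-bimodules to `k`-vector spaces. -/
def tensorEnv (M : ModuleCat.{v} (Env k A)) : ModuleCat.{v} (Env k A) ⥤ ModuleCat.{v} k where
  obj X := ModuleCat.of k ((X ⊗[k] M) ⧸ balanced X M)
  map {X Y} f := ModuleCat.ofHom <|
    (balanced X M).mapQ (balanced Y M) ((f.hom.restrictScalars k).rTensor M) <| by
      rw [balanced, Submodule.span_le]
      rintro _ ⟨a, b, x, m, rfl⟩
      refine Submodule.subset_span ⟨a, b, f.hom x, m, ?_⟩
      simp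
  map_id X := by
    ext x m
    rfl
  map_comp f g := by
    ext x m
    rfl

instance (M : ModuleCat.{v} (Env k A)) : (tensorEnv M).Additive where
  map_add {X Y f g} := by
    refine ModuleCat.hom_ext (Submodule.linearMap_qext _ (TensorProduct.ext' fun x m => ?_))
    exact congrArg (Submodule.Quotient.mk (p := balanced Y M))
      (TensorProduct.add_tmul (f.hom x) (g.hom x) m)

/-! ### Tate-Hochschild (co)homology -/

/-- The Tate-Hochschild cohomology `Ĥⁿ(A, M) = Hⁿ(Hom_{Aᵉ}(T, M))` of `A` with coefficients in
the `A`-bimodule `M`, computed with the complete resolution `T` of `A` over `Aᵉ`. -/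
def cohomology (T : CompleteResolution k (regular k A)) (M : ModuleCat.{v} (Env k A)) (n : ℤ) :
    ModuleCat.{v} k :=
  (T.T.linearYonedaObj k M).homology n

/-- The Tate-Hochschild homology `Ĥ_n(A, M) = H_n(T ⊗_{Aᵉ} M)` of `A` with coefficients in
the `A`-bimodule `M`, computed with the complete resolution `T` of `A` over `Aᵉ`. -/
def homology (T : CompleteResolution k (regular k A)) (M : ModuleCat.{v} (Env k A)) (n : ℤ) :
    ModuleCat.{v} k :=
  (((tensorEnv M).mapHomologicalComplex _).obj T.T).homology n

end Bimodules

end TateHochschild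

end

/-! All spaces involved are finite dimensional, so both dualities reduce to equalities of
dimensions, and these are computed with stable maps over the Frobenius algebra `R = Aᵉ`. Twists are
carried by automorphisms of `R`: maps into a module restricted along `τ` are `τ`-semilinear maps,
and `stableRank τ X Y` counts them modulo those that factor through projectives.

Write Ωⁿ for the image of `T_n → T_{n-1}`. Since `R` is self-injective, the degree `n` cohomology of
`τ`-semilinear maps `T → M` has the dimension of the stable `τ`-maps Ωⁿ → M (`finrank_precomp`). For
projective `X`, Nakayama duality D Hom_τ(X, M) ≅ Hom_ρ(M, X), with `ρ ∘ τ` the inverse Nakayama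
automorphism of `R`, gives a second description: stable `ρ`-maps M → Ωⁿ⁺¹
(`finrank_precomp_eq_stableRank`). Stable maps are unchanged when both arguments are replaced with
syzygies, so maps Ωⁿ → A and A → Ω⁻ⁿ have the same stable dimension (`stableRank_balance`). Hence
degree `n` in the first description matches degree `-n - 1` in the second, once the twists agree.

The inverse Nakayama automorphism of `Aᵉ` is ν⁻¹ ⊗ ν, and a diagonal twist μ ⊗ μ of the source `A`
is invisible because μ itself is an isomorphism onto the twisted bimodule (`stableRank_regular`).
For cohomology, τ = 1 ⊗ ν² has partner ρ = ν⁻¹ ⊗ ν⁻¹, a diagonal twist of the identity; this is the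
origin of ν². For homology, D(X ⊗ A) is the space of ν⁻¹ ⊗ 1-semilinear maps X → A, and the partner
1 ⊗ ν is a diagonal twist of ν⁻¹ ⊗ 1 again, so no twist survives.

A complete resolution exists because every finite dimensional `R`-module embeds in a free one with
finite dimensional cokernel, so short exact sequences can be spliced in both directions. -/

namespace TateHochschild

/-! ### Linear algebra over a field -/

section LinearAlgebra

variable {k : Type*} [Field k]

theorem finrank_range_eq_of_comm {V W V' W' : Type*} [AddCommGroup V] [Module k V]
    [AddCommGroup W] [Module k W] [AddCommGroup V'] [Module k V'] [AddCommGroup W'] [Module k W']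
    (u : V →ₗ[k] W) (u' : V' →ₗ[k] W') (e : V ≃ₗ[k] V') (e' : W ≃ₗ[k] W')
    (h : ∀ v, e' (u v) = u' (e v)) :
    Module.finrank k (LinearMap.range u) = Module.finrank k (LinearMap.range u') := by
  have h1 : (LinearMap.range u).map (e' : W →ₗ[k] W') = LinearMap.range u' := by
    ext w
    simp only [Submodule.mem_map, LinearMap.mem_range, LinearEquiv.coe_coe]
    constructor
    · rintro ⟨_, ⟨v, rfl⟩, rfl⟩
      exact ⟨e v, (h v).symm⟩
    · rintro ⟨v, rfl⟩
      exact ⟨u (e.symm v), ⟨_, rfl⟩, by rw [h, e.apply_symm_apply]⟩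
  rw [← h1, LinearEquiv.finrank_map_eq e']

theorem finrank_map_of_injective {V W : Type*} [AddCommGroup V] [Module k V]
    [AddCommGroup W] [Module k W] (f : V →ₗ[k] W) (hf : Function.Injective f)
    (p : Submodule k V) : Module.finrank k (p.map f) = Module.finrank k p :=
  (LinearEquiv.finrank_eq (Submodule.equivMapOfInjective f hf p)).symm

/-- The map induces E / (E ∩ f⁻¹P) ≅ S / P: both subspaces upstairs contain the kernel of `f` on
`E`, which cancels. This lets two stable ranks be compared on a common space `E` mapping onto both
spaces of maps. -/
theorem finrank_sub_finrank_comap {V W : Type*} [AddCommGroup V] [Module k V] [FiniteDimensional k V]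
    [AddCommGroup W] [Module k W] [FiniteDimensional k W] (f : V →ₗ[k] W)
    (E : Submodule k V) (S P : Submodule k W) (hE : E.map f = S) (hP : P ≤ S) :
    (Module.finrank k E : ℤ) - Module.finrank k (E ⊓ P.comap f : Submodule k V) =
      Module.finrank k S - Module.finrank k P := by
  have key : ∀ Q : Submodule k V, LinearMap.ker f ⊓ E ≤ Q → Q ≤ E →
      (Module.finrank k Q : ℤ) = Module.finrank k (Q.map f) +
        Module.finrank k (LinearMap.ker f ⊓ E : Submodule k V) := by
    intro Q h1 h2
    have h3 := LinearMap.finrank_range_add_finrank_ker (f.domRestrict Q)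
    rw [LinearMap.range_domRestrict, LinearMap.ker_domRestrict] at h3
    have h4 : Module.finrank k ((LinearMap.ker f).comap Q.subtype) =
        Module.finrank k (LinearMap.ker f ⊓ E : Submodule k V) := by
      rw [← finrank_map_of_injective Q.subtype Q.injective_subtype, Submodule.map_comap_subtype]
      have h5 : Q ⊓ LinearMap.ker f = LinearMap.ker f ⊓ E :=
        le_antisymm (le_inf inf_le_right (inf_le_left.trans h2)) (le_inf h1 inf_le_left)
      rw [h5]
    rw [← h3, ← h4]
    push_cast
    rfl
  have hm : (E ⊓ P.comap f).map f = P := by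
    apply le_antisymm
    · rintro _ ⟨x, hx, rfl⟩
      exact hx.2
    · intro y hy
      obtain ⟨x, hx, rfl⟩ : y ∈ E.map f := hE ▸ hP hy
      exact ⟨x, ⟨hx, hy⟩, rfl⟩
  rw [key E inf_le_right le_rfl, key (E ⊓ P.comap f) _ inf_le_left, hE, hm]
  · ring
  · refine le_inf inf_le_right fun x hx => ?_
    have : f x = 0 := hx.1
    simp [this]

end LinearAlgebra

/-! ### Semilinear maps and the maps factoring through projective modules -/

section Semilinear

variable {k : Type*} [Field k] {R : Type*} [Ring R] [Algebra k R]

/-- The `k`-linear maps `f : X → Y` with `f (r • x) = τ r • f x`. -/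
def semilinearHom (τ : R ≃ₐ[k] R) (X Y : Type*) [AddCommGroup X] [Module R X] [Module k X]
    [AddCommGroup Y] [Module R Y] [Module k Y] [IsScalarTower k R Y] :
    Submodule k (X →ₗ[k] Y) where
  carrier := {f | ∀ (r : R) (x : X), f (r • x) = τ r • f x}
  add_mem' hf hg r x := by simp [hf r x, hg r x]
  zero_mem' r x := by simp
  smul_mem' c f hf r x := by
    have := IsScalarTower.to_smulCommClass (R := k) (A := R) (M := Y)
    simp [hf r x, smul_comm c (τ r) (f x)]

/-- The span of the maps `x ↦ τ (f x) • y`, that is, the `τ`-semilinear maps which factor through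
a finitely generated projective module. -/
def projectiveHom (τ : R ≃ₐ[k] R) (X Y : Type*) [AddCommGroup X] [Module R X] [Module k X]
    [AddCommGroup Y] [Module R Y] [Module k Y] :
    Submodule k (X →ₗ[k] Y) :=
  Submodule.span k {g | ∃ (f : X →ₗ[R] R) (y : Y), ∀ x, g x = τ (f x) • y}

/-- The dimension of the space of `τ`-semilinear maps modulo those which factor through a
projective module. -/
noncomputable def stableRank (τ : R ≃ₐ[k] R) (X Y : Type*) [AddCommGroup X] [Module R X] [Module k X]
    [AddCommGroup Y] [Module R Y] [Module k Y] [IsScalarTower k R Y] : ℤ :=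
  Module.finrank k (semilinearHom τ X Y) - Module.finrank k (projectiveHom τ X Y)

/-- A module with a finite dual basis, that is, a finitely generated projective module. -/
def HasDualBasis (R : Type*) [Ring R] (X : Type*) [AddCommGroup X] [Module R X] : Prop :=
  ∃ (n : ℕ) (f : Fin n → X →ₗ[R] R) (e : Fin n → X), ∀ x, ∑ i, f i x • e i = x

theorem hasDualBasis_of_projective (R : Type*) [Ring R] (X : Type*) [AddCommGroup X] [Module R X]
    [Module.Finite R X] [Module.Projective R X] : HasDualBasis R X := by
  obtain ⟨n, f, g, -, -, h⟩ := Module.Finite.exists_comp_eq_id_of_projective R X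
  refine ⟨n, fun i => LinearMap.proj i ∘ₗ g, fun i => f (Pi.single i 1), fun x => ?_⟩
  have h1 := LinearMap.congr_fun h x
  simp only [LinearMap.comp_apply, LinearMap.id_apply] at h1
  conv_rhs => rw [← h1, pi_eq_sum_univ' (g x), map_sum]
  refine Finset.sum_congr rfl fun i _ => ?_
  rw [map_smul]
  congr 2

section Modules

variable {X Y Z X' Y' : Type*}
  [AddCommGroup X] [Module R X] [Module k X] [IsScalarTower k R X]
  [AddCommGroup Y] [Module R Y] [Module k Y] [IsScalarTower k R Y]
  [AddCommGroup Z] [Module R Z] [Module k Z] [IsScalarTower k R Z]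
  [AddCommGroup X'] [Module R X'] [Module k X'] [IsScalarTower k R X']
  [AddCommGroup Y'] [Module R Y'] [Module k Y'] [IsScalarTower k R Y']

/-- The semilinear map `x ↦ τ (f x) • y`. -/
def rankOne (τ : R ≃ₐ[k] R) (f : X →ₗ[R] R) (y : Y) : X →ₗ[k] Y where
  toFun x := τ (f x) • y
  map_add' a b := by simp [add_smul]
  map_smul' c x := by
    have h : f (c • x) = c • f x := f.map_smul_of_tower c x
    simp [h]

@[simp] theorem rankOne_apply (τ : R ≃ₐ[k] R) (f : X →ₗ[R] R) (y : Y) (x : X) :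
    rankOne τ f y x = τ (f x) • y := rfl

theorem rankOne_mem_projectiveHom (τ : R ≃ₐ[k] R) (f : X →ₗ[R] R) (y : Y) :
    rankOne τ f y ∈ projectiveHom τ X Y :=
  Submodule.subset_span ⟨f, y, fun _ => rfl⟩

theorem projectiveHom_le_iff (τ : R ≃ₐ[k] R) (p : Submodule k (X →ₗ[k] Y)) :
    projectiveHom τ X Y ≤ p ↔ ∀ (f : X →ₗ[R] R) (y : Y), rankOne τ f y ∈ p := by
  rw [projectiveHom, Submodule.span_le]
  constructor
  · exact fun h f y => h ⟨f, y, fun _ => rfl⟩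
  · rintro h g ⟨f, y, hg⟩
    have : g = rankOne τ f y := LinearMap.ext hg
    exact this ▸ h f y

theorem rankOne_mem_semilinearHom (τ : R ≃ₐ[k] R) (f : X →ₗ[R] R) (y : Y) :
    rankOne τ f y ∈ semilinearHom τ X Y :=
  fun r x => by simp [mul_smul]

theorem projectiveHom_le_semilinearHom (τ : R ≃ₐ[k] R) :
    projectiveHom τ X Y ≤ semilinearHom τ X Y :=
  (projectiveHom_le_iff τ _).2 (rankOne_mem_semilinearHom τ)

theorem comp_mem_semilinearHom {τ : R ≃ₐ[k] R} {g : X →ₗ[k] Y} (hg : g ∈ semilinearHom τ X Y)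
    (u : X' →ₗ[R] X) : g ∘ₗ u.restrictScalars k ∈ semilinearHom τ X' Y := fun r x => by
  simpa using hg r (u x)

omit [IsScalarTower k R X] in
theorem restrictScalars_comp_mem_semilinearHom {τ : R ≃ₐ[k] R} {g : X →ₗ[k] Y}
    (hg : g ∈ semilinearHom τ X Y) (u : Y →ₗ[R] Y') :
    u.restrictScalars k ∘ₗ g ∈ semilinearHom τ X Y' := fun r x => by
  simp [hg r x]

/-- Precomposition with an `R`-linear map on semilinear maps. -/
def precomp (τ : R ≃ₐ[k] R) (u : X' →ₗ[R] X) (Y : Type*) [AddCommGroup Y] [Module R Y]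
    [Module k Y] [IsScalarTower k R Y] :
    semilinearHom τ X Y →ₗ[k] semilinearHom τ X' Y :=
  (LinearMap.lcomp k Y (u.restrictScalars k)).restrict fun _ hg => comp_mem_semilinearHom hg u

@[simp] theorem precomp_apply (τ : R ≃ₐ[k] R) (u : X' →ₗ[R] X) (g : semilinearHom τ X Y) (x : X') :
    (precomp τ u Y g : X' →ₗ[k] Y) x = (g : X →ₗ[k] Y) (u x) := rfl

variable (X) in
/-- Postcomposition with an `R`-linear map on semilinear maps. -/
def postcomp (τ : R ≃ₐ[k] R) (u : Y →ₗ[R] Y') :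
    semilinearHom τ X Y →ₗ[k] semilinearHom τ X Y' :=
  (LinearMap.compRight k (u.restrictScalars k)).restrict
    fun _ hg => restrictScalars_comp_mem_semilinearHom hg u

omit [IsScalarTower k R X] in
@[simp] theorem postcomp_apply (τ : R ≃ₐ[k] R) (u : Y →ₗ[R] Y') (g : semilinearHom τ X Y) (x : X) :
    (postcomp X τ u g : X →ₗ[k] Y') x = u ((g : X →ₗ[k] Y) x) := rfl

/-- The `R`-linear functional `τ⁻¹ ∘ f ∘ g` for a `τ`-semilinear map `g`. -/
def untwist {τ : R ≃ₐ[k] R} {g : X →ₗ[k] Y} (hg : g ∈ semilinearHom τ X Y) (f : Y →ₗ[R] R) :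
    X →ₗ[R] R where
  toFun x := τ.symm (f (g x))
  map_add' := by simp
  map_smul' r x := by simp [hg r x]

theorem eq_sum_rankOne {τ : R ≃ₐ[k] R} {g : X →ₗ[k] Y} (hg : g ∈ semilinearHom τ X Y) {n : ℕ}
    {f : Fin n → X →ₗ[R] R} {e : Fin n → X} (h : ∀ x, ∑ i, f i x • e i = x) :
    g = ∑ i, rankOne τ (f i) (g (e i)) := by
  ext x
  conv_lhs => rw [← h x]
  simp [hg _ _]

theorem semilinearHom_eq_projectiveHom (hX : HasDualBasis R X) (τ : R ≃ₐ[k] R) :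
    semilinearHom τ X Y = projectiveHom τ X Y := by
  refine le_antisymm (fun g hg => ?_) (projectiveHom_le_semilinearHom τ)
  obtain ⟨n, f, e, h⟩ := hX
  rw [eq_sum_rankOne hg h]
  exact Submodule.sum_mem _ fun i _ => rankOne_mem_projectiveHom τ _ _

/-- Functionals on the semilinear maps out of a projective module are determined by their values
on the maps `x ↦ τ (f x) • m`. -/
theorem dual_semilinearHom_ext (hX : HasDualBasis R X) {τ : R ≃ₐ[k] R}
    {φ ψ : Module.Dual k (semilinearHom τ X Y)}
    (h : ∀ (f : X →ₗ[R] R) (y : Y), φ ⟨rankOne τ f y, rankOne_mem_semilinearHom τ f y⟩ =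
      ψ ⟨rankOne τ f y, rankOne_mem_semilinearHom τ f y⟩) : φ = ψ := by
  ext g
  have hle : projectiveHom τ X Y ≤
      (LinearMap.eqLocus φ ψ).map (semilinearHom τ X Y).subtype := by
    rw [projectiveHom_le_iff]
    exact fun f m => ⟨⟨rankOne τ f m, rankOne_mem_semilinearHom τ f m⟩, h f m, rfl⟩
  obtain ⟨g', hg', hgg⟩ := hle ((semilinearHom_eq_projectiveHom hX τ).le g.2)
  obtain rfl : g' = g := Subtype.ext hgg
  exact hg'

/-- Semilinear maps out of a projective module lift along surjections. -/
theorem exists_lift_semilinearHom (hX : HasDualBasis R X) {τ : R ≃ₐ[k] R} {p : Y →ₗ[R] Y'}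
    (hp : Function.Surjective p) {g : X →ₗ[k] Y'} (hg : g ∈ semilinearHom τ X Y') :
    ∃ h ∈ semilinearHom τ X Y, p.restrictScalars k ∘ₗ h = g := by
  obtain ⟨n, f, e, he⟩ := hX
  choose s hs using hp
  refine ⟨∑ i, rankOne τ (f i) (s (g (e i))),
    Submodule.sum_mem _ fun i _ => rankOne_mem_semilinearHom τ _ _, ?_⟩
  conv_rhs => rw [eq_sum_rankOne hg he]
  ext x
  simp [hs]

/-- One projective cover suffices to test for factorization: a rank one map lifts by lifting its
vector, and anything passing through `Y` expands in a dual basis of `Y`. -/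
theorem projectiveHom_eq_range_postcomp (hY : HasDualBasis R Y) {p : Y →ₗ[R] Y'}
    (hp : Function.Surjective p) (τ : R ≃ₐ[k] R) :
    projectiveHom τ X Y' =
      (LinearMap.range (postcomp X τ p)).map (semilinearHom τ X Y').subtype := by
  apply le_antisymm
  · rw [projectiveHom_le_iff]
    intro f y
    obtain ⟨y, rfl⟩ := hp y
    refine ⟨_, ⟨⟨rankOne τ f y, rankOne_mem_semilinearHom τ f y⟩, rfl⟩, ?_⟩
    ext x
    simp
  · rintro _ ⟨_, ⟨⟨g, hg⟩, rfl⟩, rfl⟩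
    obtain ⟨n, f, e, h⟩ := hY
    have : p.restrictScalars k ∘ₗ g = ∑ i, rankOne τ (untwist hg (f i)) (p (e i)) := by
      ext x
      conv_lhs => rw [LinearMap.comp_apply, ← h (g x)]
      simp [untwist]
    change p.restrictScalars k ∘ₗ g ∈ _
    rw [this]
    exact Submodule.sum_mem _ fun i _ => rankOne_mem_projectiveHom τ _ _

/-- The isomorphism on sources may itself be semilinear; composition with it absorbs `γ` into the
twist. This is how a diagonal twist of `A` is removed later. -/
theorem stableRank_congr {τ γ : R ≃ₐ[k] R} (e : X ≃ₗ[k] X') (he : ∀ (r : R) x, e (r • x) = γ r • e x)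
    (e' : Y ≃ₗ[R] Y') : stableRank τ X' Y' = stableRank (γ.trans τ) X Y := by
  have he' : ∀ (r : R) x, e.symm (r • x) = γ.symm r • e.symm x := fun r x => by
    rw [LinearEquiv.symm_apply_eq, he]
    simp
  let Φ : (X →ₗ[k] Y) ≃ₗ[k] (X' →ₗ[k] Y') := LinearEquiv.arrowCongr e (e'.restrictScalars k)
  have h1 : (semilinearHom (γ.trans τ) X Y).map (Φ : _ →ₗ[k] _) = semilinearHom τ X' Y' := by
    ext g
    constructor
    · rintro ⟨f, hf, rfl⟩ r x
      simp [Φ, LinearEquiv.arrowCongr_apply, he', hf _ _]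
    · intro hg
      refine ⟨Φ.symm g, fun r x => ?_, by simp⟩
      simp [Φ, LinearEquiv.arrowCongr_symm_apply, he, hg _ _]
  have h2 : (projectiveHom (γ.trans τ) X Y).map (Φ : _ →ₗ[k] _) = projectiveHom τ X' Y' := by
    apply le_antisymm
    · rw [Submodule.map_le_iff_le_comap, projectiveHom_le_iff]
      intro f y
      let f' : X' →ₗ[R] R :=
        { toFun := fun x => γ (f (e.symm x))
          map_add' := by simp
          map_smul' := fun r x => by simp [he'] }
      have : Φ (rankOne (γ.trans τ) f y) = rankOne τ f' (e' y) := by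
        ext x
        simp [Φ, LinearEquiv.arrowCongr_apply, f']
      rw [Submodule.mem_comap, LinearEquiv.coe_coe, this]
      exact rankOne_mem_projectiveHom _ _ _
    · rw [projectiveHom_le_iff]
      intro f y
      let f' : X →ₗ[R] R :=
        { toFun := fun x => γ.symm (f (e x))
          map_add' := by simp
          map_smul' := fun r x => by simp [he] }
      refine ⟨rankOne (γ.trans τ) f' (e'.symm y), rankOne_mem_projectiveHom _ _ _, ?_⟩
      ext x
      simp [Φ, LinearEquiv.arrowCongr_apply, f']
  rw [stableRank, stableRank, ← h1, ← h2, LinearEquiv.finrank_map_eq, LinearEquiv.finrank_map_eq]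

end Modules

end Semilinear

end TateHochschild

namespace TateHochschild

/-! ### Modules over a Frobenius algebra -/

section Frobenius

variable {k : Type*} [Field k] {R : Type*} [Ring R] [Algebra k R]

/-- A linear functional on `R` whose kernel contains no nonzero left ideal. -/
def IsFrobenius (l : R →ₗ[k] k) : Prop :=
  ∀ s : R, (∀ r : R, l (r * s) = 0) → s = 0

section Modules

variable {X Y Z X' Y' Z' : Type*}
  [AddCommGroup X] [Module R X] [Module k X] [IsScalarTower k R X]
  [AddCommGroup Y] [Module R Y] [Module k Y] [IsScalarTower k R Y]
  [AddCommGroup Z] [Module R Z] [Module k Z] [IsScalarTower k R Z]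
  [AddCommGroup X'] [Module R X'] [Module k X'] [IsScalarTower k R X']
  [AddCommGroup Y'] [Module R Y'] [Module k Y'] [IsScalarTower k R Y']
  [AddCommGroup Z'] [Module R Z'] [Module k Z'] [IsScalarTower k R Z']

/-- Every linear functional on a module over a Frobenius algebra is the composition of an
`R`-linear functional with the Frobenius functional. -/
theorem IsFrobenius.exists_linearMap [FiniteDimensional k R] {l : R →ₗ[k] k} (hl : IsFrobenius l)
    (φ : X →ₗ[k] k) : ∃ f : X →ₗ[R] R, ∀ x, l (f x) = φ x := by
  -- The map s ↦ l(· s) is an isomorphism from `R` to its dual, so r ↦ φ(r x) is represented by a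
  -- unique element, which is taken as `f x`. Uniqueness makes `f` linear over `R`.
  let Θ : R →ₗ[k] Module.Dual k R := (LinearMap.mul k R).flip.compr₂ l
  have hΘ : ∀ s r, Θ s r = l (r * s) := fun _ _ => rfl
  have inj : Function.Injective Θ := by
    rw [injective_iff_map_eq_zero]
    exact fun s hs => hl s fun r => by rw [← hΘ, hs]; rfl
  have surj : Function.Surjective Θ :=
    (LinearMap.injective_iff_surjective_of_finrank_eq_finrank
      Subspace.dual_finrank_eq.symm).1 inj
  have h : ∀ x : X, ∃ s : R, ∀ r : R, l (r * s) = φ (r • x) := fun x => by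
    obtain ⟨s, hs⟩ := surj (φ ∘ₗ (LinearMap.toSpanSingleton R X x).restrictScalars k)
    exact ⟨s, fun r => by rw [← hΘ, hs]; rfl⟩
  choose f hf using h
  have uniq : ∀ s t : R, (∀ r, l (r * s) = l (r * t)) → s = t := fun s t h =>
    sub_eq_zero.1 (hl _ fun r => by rw [mul_sub, map_sub, h, sub_self])
  refine ⟨{ toFun := f, map_add' := fun x y => ?_, map_smul' := fun t x => ?_ }, fun x => ?_⟩
  · refine uniq _ _ fun r => ?_
    rw [mul_add, map_add, hf, hf, hf, smul_add, map_add]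
  · refine uniq _ _ fun r => ?_
    rw [hf, RingHom.id_apply, smul_eq_mul, ← mul_assoc, hf, smul_smul]
  · have := hf x 1
    rwa [one_mul, one_smul] at this

omit [Module k X] [IsScalarTower k R X] in
theorem IsFrobenius.linearMap_ext {l : R →ₗ[k] k} (hl : IsFrobenius l) {f g : X →ₗ[R] R}
    (h : ∀ x, l (f x) = l (g x)) : f = g := by
  ext x
  refine sub_eq_zero.1 (hl _ fun r => ?_)
  rw [mul_sub, map_sub, ← smul_eq_mul, ← smul_eq_mul, ← map_smul, ← map_smul, h, sub_self]

/-- A Frobenius algebra is self-injective. -/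
theorem IsFrobenius.exists_extend [FiniteDimensional k R] {l : R →ₗ[k] k} (hl : IsFrobenius l)
    {i : X →ₗ[R] Y} (hi : Function.Injective i) (f : X →ₗ[R] R) :
    ∃ g : Y →ₗ[R] R, g ∘ₗ i = f := by
  obtain ⟨q, hq⟩ := LinearMap.exists_leftInverse_of_injective (i.restrictScalars k)
    (LinearMap.ker_eq_bot.2 hi)
  obtain ⟨g, hg⟩ := hl.exists_linearMap (l ∘ₗ f.restrictScalars k ∘ₗ q)
  refine ⟨g, hl.linearMap_ext fun x => ?_⟩
  have := LinearMap.congr_fun hq x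
  simp only [LinearMap.comp_apply, LinearMap.restrictScalars_apply, LinearMap.id_apply] at this
  simp [hg, this]

/-- Semilinear maps to a projective module over a Frobenius algebra extend along injections. -/
theorem IsFrobenius.exists_extend_semilinearHom [FiniteDimensional k R] {l : R →ₗ[k] k}
    (hl : IsFrobenius l) (hY : HasDualBasis R Y) {τ : R ≃ₐ[k] R} {i : X →ₗ[R] X'}
    (hi : Function.Injective i) {g : X →ₗ[k] Y} (hg : g ∈ semilinearHom τ X Y) :
    ∃ h ∈ semilinearHom τ X' Y, h ∘ₗ i.restrictScalars k = g := by
  obtain ⟨n, f, e, he⟩ := hY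
  choose f' hf' using fun j => hl.exists_extend hi (untwist hg (f j))
  refine ⟨∑ j, rankOne τ (f' j) (e j),
    Submodule.sum_mem _ fun j _ => rankOne_mem_semilinearHom τ _ _, ?_⟩
  ext x
  have h1 : ∀ j, f' j (i x) = τ.symm (f j (g x)) := fun j => LinearMap.congr_fun (hf' j) x
  conv_rhs => rw [← he (g x)]
  simp [h1]

/-- Dual to `projectiveHom_eq_range_postcomp`: self-injectivity extends the functional of a rank one
map along `i`, so one embedding into a projective suffices to test for factorization. -/
theorem IsFrobenius.projectiveHom_eq_range_precomp [FiniteDimensional k R] {l : R →ₗ[k] k}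
    (hl : IsFrobenius l) (hX : HasDualBasis R X') {i : X →ₗ[R] X'}
    (hi : Function.Injective i) (τ : R ≃ₐ[k] R) :
    projectiveHom τ X Y =
      (LinearMap.range (precomp τ i Y)).map (semilinearHom τ X Y).subtype := by
  apply le_antisymm
  · rw [projectiveHom_le_iff]
    intro f y
    obtain ⟨f', rfl⟩ := hl.exists_extend hi f
    refine ⟨_, ⟨⟨rankOne τ f' y, rankOne_mem_semilinearHom τ f' y⟩, rfl⟩, ?_⟩
    ext x
    simp
  · rintro _ ⟨_, ⟨⟨g, hg⟩, rfl⟩, rfl⟩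
    obtain ⟨n, f, e, h⟩ := hX
    have : g ∘ₗ i.restrictScalars k = ∑ j, rankOne τ (f j ∘ₗ i) (g (e j)) := by
      conv_lhs => rw [eq_sum_rankOne hg h]
      ext x
      simp
    change g ∘ₗ i.restrictScalars k ∈ _
    rw [this]
    exact Submodule.sum_mem _ fun j _ => rankOne_mem_projectiveHom τ _ _

/-- Stable maps do not change when both modules are replaced with a syzygy. -/
theorem IsFrobenius.stableRank_syzygy [FiniteDimensional k R] {l : R →ₗ[k] k}
    (hl : IsFrobenius l) (τ : R ≃ₐ[k] R)
    [FiniteDimensional k Y] [FiniteDimensional k Y']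
    (hY : HasDualBasis R Y) (hY' : HasDualBasis R Y')
    {i : X →ₗ[R] Y} {p : Y →ₗ[R] Z} (hi : Function.Injective i) (hp : Function.Surjective p)
    (h : Function.Exact i p)
    {i' : X' →ₗ[R] Y'} {p' : Y' →ₗ[R] Z'} (hi' : Function.Injective i')
    (hp' : Function.Surjective p') (h' : Function.Exact i' p') :
    stableRank τ X X' = stableRank τ Z Z' := by
  have := Module.Finite.of_injective (i.restrictScalars k) hi
  have := Module.Finite.of_injective (i'.restrictScalars k) hi'
  have := Module.Finite.of_surjective (p.restrictScalars k) hp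
  have := Module.Finite.of_surjective (p'.restrictScalars k) hp'
  obtain ⟨s, hs⟩ := LinearMap.exists_rightInverse_of_surjective (p.restrictScalars k)
    (LinearMap.range_eq_top.2 hp)
  obtain ⟨q, hq⟩ := LinearMap.exists_leftInverse_of_injective (i'.restrictScalars k)
    (LinearMap.ker_eq_bot.2 hi')
  have hs' : ∀ z, p (s z) = z := fun z => LinearMap.congr_fun hs z
  have hq' : ∀ x, q (i' x) = x := fun x => LinearMap.congr_fun hq x
  -- the maps of extensions
  let E : Submodule k (Y →ₗ[k] Y') := semilinearHom τ Y Y' ⊓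
    LinearMap.ker ((LinearMap.lcomp k Z' (i.restrictScalars k)) ∘ₗ
      LinearMap.compRight k (p'.restrictScalars k))
  have hE : ∀ f, f ∈ E ↔ f ∈ semilinearHom τ Y Y' ∧ ∀ x, p' (f (i x)) = 0 := fun f => by
    simp only [E, Submodule.mem_inf, LinearMap.mem_ker, LinearMap.ext_iff]
    rfl
  -- The `k`-linear splittings `s` and `q` define both restrictions on all `k`-linear maps; on `E`
  -- the results are independent of the splittings.
  let a : (Y →ₗ[k] Y') →ₗ[k] (Z →ₗ[k] Z') :=
    LinearMap.lcomp k Z' s ∘ₗ LinearMap.compRight k (p'.restrictScalars k)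
  let b : (Y →ₗ[k] Y') →ₗ[k] (X →ₗ[k] X') :=
    LinearMap.lcomp k X' (i.restrictScalars k) ∘ₗ LinearMap.compRight k q
  have ha : ∀ f ∈ E, ∀ y, a f (p y) = p' (f y) := fun f hf y => by
    obtain ⟨x, hx⟩ := (h (y - s (p y))).1 (by rw [map_sub, hs', sub_self])
    have h1 := ((hE f).1 hf).2 x
    rw [hx, map_sub, map_sub, sub_eq_zero] at h1
    exact h1.symm
  have hb : ∀ f ∈ E, ∀ x, i' (b f x) = f (i x) := fun f hf x => by
    obtain ⟨x', hx'⟩ := (h' (f (i x))).1 (((hE f).1 hf).2 x)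
    change i' (q (f (i x))) = _
    rw [← hx', hq']
  have mapa : E.map a = semilinearHom τ Z Z' := by
    apply le_antisymm
    · rintro _ ⟨f, hf, rfl⟩ r z
      obtain ⟨y, rfl⟩ := hp z
      rw [← map_smul, ha f hf, ha f hf, ((hE f).1 hf).1, map_smul]
    · intro g hg
      obtain ⟨f, hf, hfg⟩ := exists_lift_semilinearHom hY hp' (comp_mem_semilinearHom hg p)
      have hfg' : ∀ y, p' (f y) = g (p y) := fun y => LinearMap.congr_fun hfg y
      refine ⟨f, (hE f).2 ⟨hf, fun x => ?_⟩, ?_⟩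
      · rw [hfg', h.apply_apply_eq_zero, map_zero]
      · ext z
        change p' (f (s z)) = _
        rw [hfg', hs']
  have mapb : E.map b = semilinearHom τ X X' := by
    apply le_antisymm
    · rintro _ ⟨f, hf, rfl⟩ r x
      apply hi'
      rw [hb f hf, i.map_smul, i'.map_smul, hb f hf, ((hE f).1 hf).1]
    · intro g hg
      obtain ⟨f, hf, hfg⟩ := hl.exists_extend_semilinearHom hY' hi
        (restrictScalars_comp_mem_semilinearHom hg i')
      have hfg' : ∀ x, f (i x) = i' (g x) := fun x => LinearMap.congr_fun hfg x
      refine ⟨f, (hE f).2 ⟨hf, fun x => ?_⟩, ?_⟩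
      · rw [hfg', h'.apply_apply_eq_zero]
      · ext x
        change q (f (i x)) = _
        rw [hfg', hq']
  -- The crux: the elements of `E` inducing a projective map on quotients, and those inducing one on
  -- submodules, are the same null-homotopic maps u ∘ p + i' ∘ v.
  have comapa : ∀ f, f ∈ E ⊓ (projectiveHom τ Z Z').comap a ↔
      ∃ u ∈ semilinearHom τ Z Y', ∃ v ∈ semilinearHom τ Y X', ∀ y, f y = u (p y) + i' (v y) := by
    intro f
    rw [projectiveHom_eq_range_postcomp hY' hp']
    constructor
    · rintro ⟨hf, _, ⟨⟨u, hu⟩, rfl⟩, hfu⟩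
      have hfu' : ∀ z, p' (u z) = a f z := fun z => LinearMap.congr_fun hfu z
      have h1 : ∀ y, p' (f y - u (p y)) = 0 := fun y => by
        rw [map_sub, hfu', ha f hf, sub_self]
      have h2 : ∀ y, i' (q (f y - u (p y))) = f y - u (p y) := fun y => by
        obtain ⟨x', hx'⟩ := (h' _).1 (h1 y)
        rw [← hx', hq']
      refine ⟨u, hu, q ∘ₗ (f - u ∘ₗ p.restrictScalars k), fun r y => hi' ?_, fun y => ?_⟩
      · rw [i'.map_smul]
        change i' (q (f (r • y) - u (p (r • y)))) = τ r • i' (q (f y - u (p y)))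
        rw [h2, h2, ((hE f).1 hf).1, p.map_smul, hu, smul_sub]
      · change _ = u (p y) + i' (q (f y - u (p y)))
        rw [h2]
        abel
    · rintro ⟨u, hu, v, hv, hf⟩
      refine ⟨(hE f).2 ⟨fun r y => ?_, fun x => ?_⟩, _, ⟨⟨u, hu⟩, rfl⟩, ?_⟩
      · rw [hf, hf, map_smul, hu, hv, map_smul, smul_add]
      · rw [hf, h.apply_apply_eq_zero, map_zero, zero_add, h'.apply_apply_eq_zero]
      · ext z
        change p' (u z) = p' (f (s z))
        rw [hf, map_add, hs', h'.apply_apply_eq_zero, add_zero]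
  have comapb : ∀ f, f ∈ E ⊓ (projectiveHom τ X X').comap b ↔
      ∃ u ∈ semilinearHom τ Z Y', ∃ v ∈ semilinearHom τ Y X', ∀ y, f y = u (p y) + i' (v y) := by
    intro f
    rw [hl.projectiveHom_eq_range_precomp hY hi]
    constructor
    · rintro ⟨hf, _, ⟨⟨v, hv⟩, rfl⟩, hfv⟩
      have hfv' : ∀ x, v (i x) = b f x := fun x => LinearMap.congr_fun hfv x
      have h1 : ∀ x, f (i x) = i' (v (i x)) := fun x => by rw [hfv', hb f hf]
      have h2 : ∀ y, f (s (p y)) - i' (v (s (p y))) = f y - i' (v y) := fun y => by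
        obtain ⟨x, hx⟩ := (h (y - s (p y))).1 (by rw [map_sub, hs', sub_self])
        have h3 := h1 x
        rw [hx, map_sub, map_sub, map_sub, sub_eq_sub_iff_sub_eq_sub] at h3
        exact h3.symm
      refine ⟨(f - i'.restrictScalars k ∘ₗ v) ∘ₗ s, fun r z => ?_, v, hv, fun y => ?_⟩
      · obtain ⟨y, rfl⟩ := hp z
        change f (s (r • p y)) - i' (v (s (r • p y))) = τ r • (f (s (p y)) - i' (v (s (p y))))
        rw [← map_smul, h2, h2, ((hE f).1 hf).1, hv, map_smul, smul_sub]
      · change _ = f (s (p y)) - i' (v (s (p y))) + _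
        rw [h2]
        abel
    · rintro ⟨u, hu, v, hv, hf⟩
      refine ⟨(hE f).2 ⟨fun r y => ?_, fun x => ?_⟩, _, ⟨⟨v, hv⟩, rfl⟩, ?_⟩
      · rw [hf, hf, map_smul, hu, hv, map_smul, smul_add]
      · rw [hf, h.apply_apply_eq_zero, map_zero, zero_add, h'.apply_apply_eq_zero]
      · ext x
        change v (i x) = q (f (i x))
        rw [hf, h.apply_apply_eq_zero, map_zero, zero_add, hq']
  rw [stableRank, stableRank,
    ← finrank_sub_finrank_comap a E _ _ mapa (projectiveHom_le_semilinearHom τ),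
    ← finrank_sub_finrank_comap b E _ _ mapb (projectiveHom_le_semilinearHom τ),
    Submodule.ext fun f => (comapa f).trans (comapb f).symm]

/-- The dimension of the cohomology of `Hom(-, M)` on an exact sequence of projective modules. -/
theorem IsFrobenius.finrank_precomp [FiniteDimensional k R] {l : R →ₗ[k] k}
    (hl : IsFrobenius l) (τ : R ≃ₐ[k] R) {M : Type*} [AddCommGroup M] [Module R M] [Module k M]
    [IsScalarTower k R M] [FiniteDimensional k M] [FiniteDimensional k Y]
    (hZ : HasDualBasis R Z) {d : X →ₗ[R] Y} {d' : Y →ₗ[R] Z} (h : Function.Exact d d') :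
    (Module.finrank k (semilinearHom τ Y M) : ℤ) -
        Module.finrank k (LinearMap.range (precomp τ d' M)) -
        Module.finrank k (LinearMap.range (precomp τ d M)) =
      stableRank τ (LinearMap.range d') M := by
  let q : Y →ₗ[R] LinearMap.range d' := d'.rangeRestrict
  have hq : Function.Surjective q := d'.surjective_rangeRestrict
  have hinj : Function.Injective (precomp τ q M) := by
    intro g g' hg
    ext z
    obtain ⟨y, rfl⟩ := hq z
    rw [← precomp_apply, hg, precomp_apply]
  -- Cocycles are the maps that factor through the image of `d'`; coboundaries are those whose
  -- factor extends to `Z`, which are the projective ones.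
  have hker : LinearMap.range (precomp τ q M) = LinearMap.ker (precomp τ d M) := by
    ext g
    constructor
    · rintro ⟨g, rfl⟩
      ext x
      have : q (d x) = 0 := Subtype.ext (h.apply_apply_eq_zero x)
      simp [this]
    · intro hg
      have hg' : ∀ x, (g : Y →ₗ[k] M) (d x) = 0 := fun x => by
        rw [← precomp_apply, LinearMap.mem_ker.1 hg]
        rfl
      obtain ⟨s, hs⟩ := LinearMap.exists_rightInverse_of_surjective (q.restrictScalars k)
        (LinearMap.range_eq_top.2 hq)
      have hs' : ∀ y, (g : Y →ₗ[k] M) (s (q y)) = (g : Y →ₗ[k] M) y := fun y => by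
        have h1 : q (s (q y)) = q y := LinearMap.congr_fun hs (q y)
        obtain ⟨x, hx⟩ := (h (s (q y) - y)).1
          (by rw [map_sub, sub_eq_zero]; exact congrArg Subtype.val h1)
        rw [← sub_eq_zero, ← map_sub, ← hx, hg']
      refine ⟨⟨(g : Y →ₗ[k] M) ∘ₗ s, fun r z => ?_⟩, ?_⟩
      · obtain ⟨y, rfl⟩ := hq z
        rw [← map_smul, LinearMap.comp_apply, LinearMap.comp_apply, hs', hs', g.2]
      · ext y
        exact hs' y
  have hproj : Module.finrank k (LinearMap.range (precomp τ d' M)) =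
      Module.finrank k (projectiveHom τ (LinearMap.range d') M) := by
    rw [hl.projectiveHom_eq_range_precomp hZ (LinearMap.range d').injective_subtype,
      finrank_map_of_injective _ (Submodule.injective_subtype _),
      ← finrank_map_of_injective _ hinj, ← LinearMap.range_comp]
    rfl
  have h1 := LinearMap.finrank_range_add_finrank_ker (precomp τ d M)
  rw [← hker, LinearMap.finrank_range_of_inj hinj] at h1
  rw [stableRank, hproj, ← h1]
  push_cast
  ring

/-- The dimension of the homology of `Hom(M, -)` on an exact sequence of projective modules. -/
theorem finrank_postcomp (τ : R ≃ₐ[k] R) {M : Type*} [AddCommGroup M] [Module R M]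
    [Module k M] [IsScalarTower k R M] [FiniteDimensional k M] [FiniteDimensional k Y]
    (hX : HasDualBasis R X) {d : X →ₗ[R] Y} {d' : Y →ₗ[R] Z} (h : Function.Exact d d') :
    (Module.finrank k (semilinearHom τ M Y) : ℤ) -
        Module.finrank k (LinearMap.range (postcomp M τ d')) -
        Module.finrank k (LinearMap.range (postcomp M τ d)) =
      stableRank τ M (LinearMap.range d) := by
  let i : LinearMap.range d →ₗ[R] Y := (LinearMap.range d).subtype
  have hinj : Function.Injective (postcomp M τ i) := by
    intro g g' hg
    ext z
    have := LinearMap.congr_fun (congrArg Subtype.val hg) z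
    exact this
  have hker : LinearMap.range (postcomp M τ i) = LinearMap.ker (postcomp M τ d') := by
    ext g
    constructor
    · rintro ⟨g, rfl⟩
      ext x
      obtain ⟨y, hy⟩ := ((g : M →ₗ[k] LinearMap.range d) x).2
      change d' ((g : M →ₗ[k] LinearMap.range d) x : Y) = 0
      rw [← hy, h.apply_apply_eq_zero]
    · intro hg
      have hg' : ∀ x, d' ((g : M →ₗ[k] Y) x) = 0 := fun x =>
        LinearMap.congr_fun (congrArg Subtype.val (LinearMap.mem_ker.1 hg)) x
      refine ⟨⟨{ toFun := fun x => ⟨(g : M →ₗ[k] Y) x, (h _).1 (hg' x)⟩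
                 map_add' := fun x y => Subtype.ext (map_add _ x y)
                 map_smul' := fun c x => Subtype.ext (map_smul _ c x) },
                fun r x => Subtype.ext (g.2 r x)⟩, rfl⟩
  -- Cycles are the maps landing in the image of `d`; boundaries are those that lift to the
  -- projective `X`.
  have hproj : Module.finrank k (LinearMap.range (postcomp M τ d)) =
      Module.finrank k (projectiveHom τ M (LinearMap.range d)) := by
    rw [projectiveHom_eq_range_postcomp hX d.surjective_rangeRestrict,
      finrank_map_of_injective _ (Submodule.injective_subtype _),
      ← finrank_map_of_injective (postcomp M τ i) hinj
        (LinearMap.range (postcomp M τ d.rangeRestrict)), ← LinearMap.range_comp]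
    rfl
  have h1 := LinearMap.finrank_range_add_finrank_ker (postcomp M τ d')
  rw [← hker, LinearMap.finrank_range_of_inj hinj] at h1
  rw [stableRank, hproj, ← h1]
  push_cast
  ring

/-- The pairing of maps `M → X` with maps `X → M` given by a dual basis of `X`, and its
description on the maps `x ↦ τ (f x) • m`. -/
theorem exists_trace_pairing {l : R →ₗ[k] k} {τ ρ : R ≃ₐ[k] R}
    (hτρ : ∀ r s, l (ρ (τ r) * s) = l (s * r)) (hX : HasDualBasis R X) (M : Type*)
    [AddCommGroup M] [Module R M] [Module k M] [IsScalarTower k R M] :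
    ∃ Θ : semilinearHom ρ M X →ₗ[k] Module.Dual k (semilinearHom τ X M),
      ∀ (h : semilinearHom ρ M X) (f : X →ₗ[R] R) (m : M),
        Θ h ⟨rankOne τ f m, rankOne_mem_semilinearHom τ f m⟩ = l (f ((h : M →ₗ[k] X) m)) := by
  obtain ⟨n, f, e, he⟩ := hX
  -- This is a twisted trace of h ∘ g. The hypothesis `hτρ` moves the twisted scalar past `l`, after
  -- which the dual basis sums away.
  refine ⟨LinearMap.mk₂ k (fun h g => ∑ i, l (f i ((h : M →ₗ[k] X) ((g : X →ₗ[k] M) (e i)))))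
    (fun h h' g => by simp [Finset.sum_add_distrib])
    (fun c h g => by simp [Finset.mul_sum, LinearMap.map_smul_of_tower])
    (fun h g g' => by simp [Finset.sum_add_distrib])
    (fun c h g => by simp [Finset.mul_sum, LinearMap.map_smul_of_tower]), fun h f' m => ?_⟩
  have h1 : ∀ i, l (f i ((h : M →ₗ[k] X) (τ (f' (e i)) • m))) =
      l (f' (f i ((h : M →ₗ[k] X) m) • e i)) := fun i => by
    rw [h.2, map_smul, smul_eq_mul, hτρ, map_smul, smul_eq_mul]
  simp only [LinearMap.mk₂_apply, rankOne_apply, h1]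
  rw [← map_sum, ← map_sum, he]

/-- Nakayama duality for projective `X`. Composition with `l` identifies the `R`-dual of `X` with
its `k`-dual, so a functional on maps X → M, tested on rank one maps, assigns to each `m` an element
of the double dual of `X`, that is, of `X`. The explicit formula makes the isomorphism natural in
`X`. -/
theorem IsFrobenius.exists_nakayama [FiniteDimensional k R] {l : R →ₗ[k] k} (hl : IsFrobenius l)
    {τ ρ : R ≃ₐ[k] R} (hτρ : ∀ r s, l (ρ (τ r) * s) = l (s * r)) (hX : HasDualBasis R X)
    (M : Type*) [AddCommGroup M] [Module R M] [Module k M] [IsScalarTower k R M]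
    [FiniteDimensional k M] [FiniteDimensional k X] :
    ∃ Θ : semilinearHom ρ M X ≃ₗ[k] Module.Dual k (semilinearHom τ X M),
      ∀ (h : semilinearHom ρ M X) (f : X →ₗ[R] R) (m : M),
        Θ h ⟨rankOne τ f m, rankOne_mem_semilinearHom τ f m⟩ = l (f ((h : M →ₗ[k] X) m)) := by
  obtain ⟨Θ, hΘ⟩ := exists_trace_pairing hτρ hX M
  have inj : Function.Injective Θ := by
    rw [injective_iff_map_eq_zero]
    intro h hh
    obtain ⟨n, f, e, he⟩ := hX
    ext m
    change (h : M →ₗ[k] X) m = 0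
    rw [← he ((h : M →ₗ[k] X) m)]
    refine Finset.sum_eq_zero fun i _ => ?_
    rw [hl (f i ((h : M →ₗ[k] X) m)) fun r => ?_, zero_smul]
    have h1 : l (f i ((h : M →ₗ[k] X) (ρ.symm r • m))) = 0 := by rw [← hΘ, hh]; rfl
    rwa [h.2, map_smul, AlgEquiv.apply_symm_apply, smul_eq_mul] at h1
  have surj : Function.Surjective Θ := by
    intro ψ
    -- the map `M → X` attached to `ψ` is determined by its composition with `k`-linear functionals
    let ω : M →ₗ[k] Module.Dual k (X →ₗ[R] R) := LinearMap.mk₂ k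
      (fun m f => ψ ⟨rankOne τ f m, rankOne_mem_semilinearHom τ f m⟩)
      (fun m m' f => by
        rw [← map_add]; congr 1; ext x; simp)
      (fun c m f => by
        have := IsScalarTower.to_smulCommClass (R := k) (A := R) (M := M)
        rw [← map_smul]; congr 1; ext x; simp [smul_comm c])
      (fun m f f' => by
        rw [← map_add]; congr 1; ext x; simp [add_smul])
      (fun c m f => by
        rw [← map_smul]; congr 1; ext x; simp)
    let L : (X →ₗ[R] R) →ₗ[k] Module.Dual k X :=
      { toFun := fun f => l ∘ₗ f.restrictScalars k
        map_add' := fun f f' => by ext x; simp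
        map_smul' := fun c f => by ext x; simp }
    have hL : Function.Bijective L :=
      ⟨fun f f' h => hl.linearMap_ext fun x => LinearMap.congr_fun h x,
        fun φ => (hl.exists_linearMap φ).imp fun f hf => LinearMap.ext hf⟩
    let L' := LinearEquiv.ofBijective L hL
    let h : M →ₗ[k] X := (Module.evalEquiv k X).symm.toLinearMap ∘ₗ
      L'.symm.toLinearMap.dualMap ∘ₗ ω
    have hh : ∀ m f, l (f (h m)) = ψ ⟨rankOne τ f m, rankOne_mem_semilinearHom τ f m⟩ := by
      intro m f
      change L' f ((Module.evalEquiv k X).symm (L'.symm.toLinearMap.dualMap (ω m))) = _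
      rw [Module.apply_evalEquiv_symm_apply]
      change ω m (L'.symm (L' f)) = _
      rw [LinearEquiv.symm_apply_apply]
      rfl
    have ext' : ∀ x y : X, (∀ f : X →ₗ[R] R, l (f x) = l (f y)) → x = y := fun x y hxy => by
      rw [← sub_eq_zero, ← Module.forall_dual_apply_eq_zero_iff k]
      intro φ
      obtain ⟨f, hf⟩ := hl.exists_linearMap φ
      rw [← hf, map_sub, map_sub, hxy, sub_self]
    have hmem : h ∈ semilinearHom ρ M X := by
      intro r m
      obtain ⟨t, rfl⟩ := τ.surjective r
      refine ext' _ _ fun f => ?_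
      rw [f.map_smul, smul_eq_mul, hτρ]
      -- Right multiplication by `t` on `R` is left linear, so it can be absorbed into the
      -- functional `f`; in the rank one map it becomes the action of `τ t` on `m`.
      change _ = l ((LinearMap.toSpanSingleton R R t ∘ₗ f) (h m))
      rw [hh, hh]
      congr 2
      ext x
      simp [mul_smul]
    exact ⟨⟨h, hmem⟩, dual_semilinearHom_ext hX fun f m => by rw [hΘ, hh]⟩
  exact ⟨LinearEquiv.ofBijective Θ ⟨inj, surj⟩, hΘ⟩

/-- Nakayama duality identifies the ranks of pre- and postcomposition with a map of projective
modules. -/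
theorem IsFrobenius.finrank_range_postcomp_eq [FiniteDimensional k R] {l : R →ₗ[k] k}
    (hl : IsFrobenius l) {τ ρ : R ≃ₐ[k] R} (hτρ : ∀ r s, l (ρ (τ r) * s) = l (s * r))
    (hX : HasDualBasis R X) (hY : HasDualBasis R Y) (M : Type*) [AddCommGroup M] [Module R M]
    [Module k M] [IsScalarTower k R M] [FiniteDimensional k M] [FiniteDimensional k X]
    [FiniteDimensional k Y] (u : X →ₗ[R] Y) :
    Module.finrank k (LinearMap.range (postcomp M ρ u)) =
      Module.finrank k (LinearMap.range (precomp τ u M)) := by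
  obtain ⟨Θ, hΘ⟩ := hl.exists_nakayama hτρ hX M
  obtain ⟨Θ', hΘ'⟩ := hl.exists_nakayama hτρ hY M
  rw [← LinearMap.finrank_range_dualMap_eq_finrank_range (precomp τ u M)]
  refine finrank_range_eq_of_comm (postcomp M ρ u) _ Θ Θ' fun h =>
    dual_semilinearHom_ext hY fun f m => ?_
  rw [hΘ']
  exact (hΘ h (f ∘ₗ u) m).symm

theorem IsFrobenius.finrank_semilinearHom_eq [FiniteDimensional k R] {l : R →ₗ[k] k}
    (hl : IsFrobenius l) {τ ρ : R ≃ₐ[k] R} (hτρ : ∀ r s, l (ρ (τ r) * s) = l (s * r))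
    (hX : HasDualBasis R X) (M : Type*) [AddCommGroup M] [Module R M]
    [Module k M] [IsScalarTower k R M] [FiniteDimensional k M] [FiniteDimensional k X] :
    Module.finrank k (semilinearHom ρ M X) = Module.finrank k (semilinearHom τ X M) := by
  obtain ⟨Θ, -⟩ := hl.exists_nakayama hτρ hX M
  rw [Θ.finrank_eq, Subspace.dual_finrank_eq]

/-- The cohomology of `Hom(-, M)` on an exact sequence of projective modules in terms of stable
maps out of `M`. -/
theorem IsFrobenius.finrank_precomp_eq_stableRank [FiniteDimensional k R] {l : R →ₗ[k] k}
    (hl : IsFrobenius l) {τ ρ : R ≃ₐ[k] R} (hτρ : ∀ r s, l (ρ (τ r) * s) = l (s * r))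
    {M : Type*} [AddCommGroup M] [Module R M] [Module k M] [IsScalarTower k R M]
    [FiniteDimensional k M] [FiniteDimensional k X] [FiniteDimensional k Y] [FiniteDimensional k Z]
    (hX : HasDualBasis R X) (hY : HasDualBasis R Y) (hZ : HasDualBasis R Z)
    {d : X →ₗ[R] Y} {d' : Y →ₗ[R] Z} (h : Function.Exact d d') :
    (Module.finrank k (semilinearHom τ Y M) : ℤ) -
        Module.finrank k (LinearMap.range (precomp τ d' M)) -
        Module.finrank k (LinearMap.range (precomp τ d M)) =
      stableRank ρ M (LinearMap.range d) := by
  rw [← finrank_postcomp ρ hX h, hl.finrank_semilinearHom_eq hτρ hY,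
    hl.finrank_range_postcomp_eq hτρ hX hY, hl.finrank_range_postcomp_eq hτρ hY hZ]

end Modules

end Frobenius

end TateHochschild

namespace TateHochschild

/-! ### Dimensions of homology from ranks of differentials -/

section Homology

variable {k : Type u} [Field k]

theorem finrank_shortComplex_homology (S : ShortComplex (ModuleCat.{v} k))
    [FiniteDimensional k S.X₂] :
    FiniteDimensional k S.homology ∧ (Module.finrank k S.homology : ℤ) =
      Module.finrank k S.X₂ - Module.finrank k (LinearMap.range S.f.hom) -
        Module.finrank k (LinearMap.range S.g.hom) := by
  let e : S.homology ≃ₗ[k] (LinearMap.ker S.g.hom ⧸ LinearMap.range S.moduleCatToCycles) :=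
    S.moduleCatHomologyIso.toLinearEquiv
  refine ⟨Module.Finite.equiv e.symm, ?_⟩
  have h1 : LinearMap.range S.f.hom =
      (LinearMap.range S.moduleCatToCycles).map (LinearMap.ker S.g.hom).subtype := by
    rw [← LinearMap.range_comp]
    rfl
  have h2 := Submodule.finrank_quotient_add_finrank (LinearMap.range S.moduleCatToCycles)
  have h3 := LinearMap.finrank_range_add_finrank_ker S.g.hom
  rw [h1, finrank_map_of_injective _ (Submodule.injective_subtype _), e.finrank_eq, ← h3, ← h2]
  push_cast
  ring

theorem finrank_homology {ι : Type*} {c : ComplexShape ι}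
    (K : HomologicalComplex (ModuleCat.{v} k) c) {i j l : ι} (hi : c.prev j = i)
    (hl : c.next j = l) [FiniteDimensional k (K.X j)] :
    FiniteDimensional k (K.homology j) ∧ (Module.finrank k (K.homology j) : ℤ) =
      Module.finrank k (K.X j) - Module.finrank k (LinearMap.range (K.d i j).hom) -
        Module.finrank k (LinearMap.range (K.d j l).hom) := by
  have : FiniteDimensional k (K.sc' i j l).X₂ := inferInstanceAs (FiniteDimensional k (K.X j))
  obtain ⟨h1, h2⟩ := finrank_shortComplex_homology (K.sc' i j l)
  let e : K.homology j ≃ₗ[k] (K.sc' i j l).homology :=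
    (K.homologyIsoSc' i j l hi hl).toLinearEquiv
  exact ⟨Module.Finite.equiv e.symm, by rw [e.finrank_eq, h2]; rfl⟩

variable {R : Type v} [Ring R] [Algebra k R]

/-- Morphisms to a module which is the restriction of `N` along `τ` are `τ`-semilinear maps
to `N`. -/
def homEquivSemilinearHom {N' N : ModuleCat.{v} R} {τ : R ≃ₐ[k] R} (e : N' ≃ₗ[k] N)
    (he : ∀ (r : R) (x : N'), e (r • x) = τ r • e x) (X : ModuleCat.{v} R) :
    (X ⟶ N') ≃ₗ[k] semilinearHom τ X N where
  toFun f := ⟨e.toLinearMap ∘ₗ f.hom.restrictScalars k, fun r x => by simp [he]⟩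
  map_add' f g := by ext x; simp
  map_smul' c f := by ext x; simp
  invFun g := ModuleCat.ofHom
    { toFun := fun x => e.symm ((g : X →ₗ[k] N) x)
      map_add' := by simp
      map_smul' := fun r x => by
        rw [g.2, LinearEquiv.symm_apply_eq, RingHom.id_apply, he, LinearEquiv.apply_symm_apply] }
  left_inv f := by ext x; simp
  right_inv g := by ext x; simp

theorem finrank_linearYonedaObj_homology [FiniteDimensional k R] (T : ChainComplex (ModuleCat.{v} R) ℤ)
    (hT : ∀ n, FiniteDimensional k (T.X n)) {N' N : ModuleCat.{v} R} [FiniteDimensional k N]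
    {τ : R ≃ₐ[k] R} (e : N' ≃ₗ[k] N)
    (he : ∀ (r : R) (x : N'), e (r • x) = τ r • e x) (n : ℤ) :
    FiniteDimensional k ((T.linearYonedaObj k N').homology (n + 1)) ∧
      (Module.finrank k ((T.linearYonedaObj k N').homology (n + 1)) : ℤ) =
        Module.finrank k (semilinearHom τ (T.X (n + 1)) N) -
          Module.finrank k (LinearMap.range (precomp τ (T.d (n + 1) n).hom N)) -
          Module.finrank k (LinearMap.range (precomp τ (T.d (n + 1 + 1) (n + 1)).hom N)) := by
  have h1 : FiniteDimensional k ((T.linearYonedaObj k N').X (n + 1)) :=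
    Module.Finite.equiv (homEquivSemilinearHom e he (T.X (n + 1))).symm
  obtain ⟨h2, h3⟩ := finrank_homology (T.linearYonedaObj k N') (i := n) (j := n + 1)
    (l := n + 1 + 1) (by simp) (by simp)
  refine ⟨h2, ?_⟩
  rw [h3, (homEquivSemilinearHom e he (T.X (n + 1))).finrank_eq.symm,
    ← finrank_range_eq_of_comm ((T.linearYonedaObj k N').d n (n + 1)).hom
      (precomp τ (T.d (n + 1) n).hom N) (homEquivSemilinearHom e he (T.X n))
      (homEquivSemilinearHom e he (T.X (n + 1))) fun f => rfl,
    ← finrank_range_eq_of_comm ((T.linearYonedaObj k N').d (n + 1) (n + 1 + 1)).hom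
      (precomp τ (T.d (n + 1 + 1) (n + 1)).hom N) (homEquivSemilinearHom e he (T.X (n + 1)))
      (homEquivSemilinearHom e he (T.X (n + 1 + 1))) fun f => rfl]
  rfl

end Homology

/-! ### Syzygies in complete resolutions -/

section CompleteResolution

variable {k : Type u} [Field k] {R : Type v} [Ring R] [Algebra k R]

/-- The image of the differential `T_{n+1} → T_n`. -/
abbrev syzygy {ι : Type*} [AddRightCancelSemigroup ι] [One ι] (T : ChainComplex (ModuleCat.{v} R) ι)
    (n : ι) : Submodule R (T.X n) :=
  LinearMap.range (T.d (n + 1) n).hom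

namespace CompleteResolution

variable {M : ModuleCat.{v} R} (T : CompleteResolution k M)

theorem exact (n : ℤ) : Function.Exact (T.T.d (n + 1 + 1) (n + 1)).hom (T.T.d (n + 1) n).hom := by
  have h := (HomologicalComplex.exactAt_iff' T.T (n + 1 + 1) (n + 1) n (by simp) (by simp)).1
    (T.acyclic (n + 1))
  exact (ShortComplex.ShortExact.moduleCat_exact_iff_function_exact _).1 h

theorem hasDualBasis_T (n : ℤ) : HasDualBasis R (T.T.X n) := by
  have := T.finite_T n
  have := T.projective_T n
  exact hasDualBasis_of_projective R _

theorem finiteDimensional_T [FiniteDimensional k R] (n : ℤ) : FiniteDimensional k (T.T.X n) := by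
  have := T.finite_T n
  exact Module.Finite.trans R _

theorem hasDualBasis_P (n : ℕ) : HasDualBasis R (T.P.complex.X n) := by
  have := T.finite_P n
  have : Module.Projective R (T.P.complex.X n) :=
    (IsProjective.iff_projective _).2 (T.P.projective n)
  exact hasDualBasis_of_projective R _

theorem finiteDimensional_P [FiniteDimensional k R] (n : ℕ) :
    FiniteDimensional k (T.P.complex.X n) := by
  have := T.finite_P n
  exact Module.Finite.trans R _

theorem exact_P (n : ℕ) :
    Function.Exact (T.P.complex.d (n + 1 + 1) (n + 1)).hom (T.P.complex.d (n + 1) n).hom :=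
  (ShortComplex.ShortExact.moduleCat_exact_iff_function_exact _).1 (T.P.exact_succ n)

/-- The augmentation of the projective resolution. -/
noncomputable def ε : T.P.complex.X 0 →ₗ[R] M := (T.P.π.f 0).hom

theorem exact_ε : Function.Exact (T.P.complex.d 1 0).hom T.ε :=
  (ShortComplex.ShortExact.moduleCat_exact_iff_function_exact _).1 T.P.exact₀

theorem surjective_ε : Function.Surjective T.ε :=
  (ModuleCat.epi_iff_surjective (T.P.π.f 0)).1 inferInstance

theorem exact_syzygy_T (n : ℤ) : Function.Exact (syzygy T.T (n + 1)).subtype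
    (T.T.d (n + 1) n).hom.rangeRestrict := fun x => by
  rw [← Subtype.val_inj]
  simpa using T.exact n x

theorem exact_syzygy_P (n : ℕ) : Function.Exact (syzygy T.P.complex (n + 1)).subtype
    (T.P.complex.d (n + 1) n).hom.rangeRestrict := fun x => by
  rw [← Subtype.val_inj]
  simpa using T.exact_P n x

theorem exact_syzygy_ε : Function.Exact (syzygy T.P.complex 0).subtype T.ε := fun x => by
  simpa using T.exact_ε x

/-- Two consecutive isomorphisms among the `θ n` identify the images of the differentials. Only in
high degrees is `T` tied to the resolved module, so other degrees are reached by shifting. -/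
theorem exists_syzygy_equiv :
    ∃ n₀ : ℕ, ∀ n : ℕ, n₀ ≤ n → Nonempty (syzygy T.T (n : ℤ) ≃ₗ[R] syzygy T.P.complex n) := by
  obtain ⟨n₀, h⟩ := T.isIso_θ
  refine ⟨n₀, fun n hn => ?_⟩
  have h1 := h n hn
  have h2 := h (n + 1) (by lia)
  let e : T.T.X n ≃ₗ[R] T.P.complex.X n := (asIso (T.θ n)).toLinearEquiv
  have hs : Function.Surjective (T.θ (n + 1)).hom :=
    (asIso (T.θ (n + 1))).toLinearEquiv.surjective
  have hc : ∀ x, (T.P.complex.d (n + 1) n).hom ((T.θ (n + 1)).hom x) =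
      e ((T.T.d ((n + 1 : ℕ) : ℤ) n).hom x) := fun x =>
    LinearMap.congr_fun (congrArg ModuleCat.Hom.hom (T.comm n)) x
  refine ⟨(e.submoduleMap _).trans (LinearEquiv.ofEq _ _ ?_)⟩
  ext y
  constructor
  · rintro ⟨_, ⟨x, rfl⟩, rfl⟩
    exact ⟨(T.θ (n + 1)).hom x, hc x⟩
  · rintro ⟨z, rfl⟩
    obtain ⟨x, rfl⟩ := hs z
    exact ⟨_, ⟨x, rfl⟩, (hc x).symm⟩

variable [FiniteDimensional k R] {l : R →ₗ[k] k}

theorem finiteDimensional_M (T : CompleteResolution k M) : FiniteDimensional k M :=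
  have := T.finiteDimensional_P 0
  Module.Finite.of_surjective (T.ε.restrictScalars k) T.surjective_ε

/-- Both arguments are shifted by `n + 1` syzygies, along `T` on the left and along the projective
resolution of `N` on the right. The offset 1 appears because `N` is the cokernel of the differential
into degree 0. -/
theorem stableRank_syzygy_left (hl : IsFrobenius l) (τ : R ≃ₐ[k] R) {N : ModuleCat.{v} R}
    (T' : CompleteResolution k N) (j : ℤ) (n : ℕ) :
    stableRank τ (syzygy T.T j) N =
      stableRank τ (syzygy T.T (j + 1 + n)) (syzygy T'.P.complex n) := by
  have := T.finiteDimensional_T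
  have := T'.finiteDimensional_P
  have := T'.finiteDimensional_M
  induction n with
  | zero =>
    rw [Nat.cast_zero, add_zero]
    exact (hl.stableRank_syzygy τ (T.hasDualBasis_T _) (T'.hasDualBasis_P 0)
      (Submodule.injective_subtype _) (LinearMap.surjective_rangeRestrict _)
      (T.exact_syzygy_T j) (Submodule.injective_subtype _) T'.surjective_ε
      T'.exact_syzygy_ε).symm
  | succ n ih =>
    rw [ih, Nat.cast_succ, ← add_assoc]
    exact (hl.stableRank_syzygy τ (T.hasDualBasis_T _) (T'.hasDualBasis_P _)
      (Submodule.injective_subtype _) (LinearMap.surjective_rangeRestrict _)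
      (T.exact_syzygy_T _) (Submodule.injective_subtype _)
      (LinearMap.surjective_rangeRestrict _) (T'.exact_syzygy_P n)).symm

theorem stableRank_syzygy_right (hl : IsFrobenius l) (τ : R ≃ₐ[k] R) {N : ModuleCat.{v} R}
    (T' : CompleteResolution k N) (j : ℤ) (n : ℕ) :
    stableRank τ M (syzygy T'.T j) =
      stableRank τ (syzygy T.P.complex n) (syzygy T'.T (j + 1 + n)) := by
  have := T'.finiteDimensional_T
  have := T.finiteDimensional_P
  have := T.finiteDimensional_M
  induction n with
  | zero =>
    rw [Nat.cast_zero, add_zero]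
    exact (hl.stableRank_syzygy τ (T.hasDualBasis_P 0) (T'.hasDualBasis_T _)
      (Submodule.injective_subtype _) T.surjective_ε T.exact_syzygy_ε
      (Submodule.injective_subtype _) (LinearMap.surjective_rangeRestrict _)
      (T'.exact_syzygy_T j)).symm
  | succ n ih =>
    rw [ih, Nat.cast_succ, ← add_assoc]
    exact (hl.stableRank_syzygy τ (T.hasDualBasis_P _) (T'.hasDualBasis_T _)
      (Submodule.injective_subtype _) (LinearMap.surjective_rangeRestrict _)
      (T.exact_syzygy_P n) (Submodule.injective_subtype _)
      (LinearMap.surjective_rangeRestrict _) (T'.exact_syzygy_T _)).symm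

/-- The stable maps from a syzygy of `M` to `N` are the stable maps from `M` to the corresponding
cosyzygy of `N`. -/
theorem stableRank_balance (hl : IsFrobenius l) (τ : R ≃ₐ[k] R) {N : ModuleCat.{v} R}
    (T' : CompleteResolution k N) (i j : ℤ) (hij : i + j = -2) :
    stableRank τ (syzygy T.T i) N = stableRank τ M (syzygy T'.T j) := by
  obtain ⟨n₀, h⟩ := T.exists_syzygy_equiv
  obtain ⟨n₁, h'⟩ := T'.exists_syzygy_equiv
  -- Both sides are shifted until every syzygy lies in the range where `T` and `P` agree; the
  -- positive and negative parts of `i + 1` give the required difference.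
  obtain ⟨a, b, ha, hb, hab⟩ : ∃ a b : ℕ, n₀ ≤ a ∧ n₁ ≤ b ∧ i + 1 + b = a := by
    refine ⟨n₀ + n₁ + (i + 1).toNat, n₀ + n₁ + (-(i + 1)).toNat, ?_, ?_, ?_⟩ <;> lia
  obtain ⟨e⟩ := h a ha
  obtain ⟨e'⟩ := h' b hb
  have hba : j + 1 + a = b := by lia
  rw [T.stableRank_syzygy_left hl τ T' i b, T.stableRank_syzygy_right hl τ T' j a, hab, hba,
    stableRank_congr (τ := τ) (γ := AlgEquiv.refl) (LinearEquiv.refl k _) (fun _ _ => rfl) e',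
    stableRank_congr (τ := τ) (γ := AlgEquiv.refl) (e.restrictScalars k) (fun r x => e.map_smul r x)
      (LinearEquiv.refl R _)]

end CompleteResolution

end CompleteResolution

end TateHochschild

namespace TateHochschild

/-! ### The enveloping algebra and its twists -/

section Enveloping

variable {k : Type u} [Field k] {A : Type v} [Ring A] [Algebra k A]

theorem env_induction {p : Env k A → Prop} (ht : ∀ a b : A, p (a ⊗ₜ[k] op b))
    (ha : ∀ r s, p r → p s → p (r + s)) (r : Env k A) : p r :=
  TensorProduct.induction_on r (by simpa using ht 0 0) (fun a b => ht a b.unop) ha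

/-- The automorphism `α ⊗ β` of the enveloping algebra. -/
def envMap (α β : A ≃ₐ[k] A) : Env k A ≃ₐ[k] Env k A :=
  Algebra.TensorProduct.congr α (AlgEquiv.op β)

@[simp] theorem envMap_tmul (α β : A ≃ₐ[k] A) (a b : A) :
    envMap α β (a ⊗ₜ[k] op b) = α a ⊗ₜ[k] op (β b) := rfl

theorem env_algEquiv_ext {σ τ : Env k A ≃ₐ[k] Env k A}
    (h : ∀ a b : A, σ (a ⊗ₜ[k] op b) = τ (a ⊗ₜ[k] op b)) : σ = τ := by
  ext r
  induction r using env_induction with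
  | ht a b => exact h a b
  | ha r s hr hs => rw [map_add, map_add, hr, hs]

theorem envMap_one_one : envMap (1 : A ≃ₐ[k] A) 1 = AlgEquiv.refl :=
  env_algEquiv_ext fun _ _ => rfl

theorem envMap_trans (α β α' β' : A ≃ₐ[k] A) :
    (envMap α β).trans (envMap α' β') = envMap (α.trans α') (β.trans β') :=
  env_algEquiv_ext fun _ _ => rfl

theorem regular_ksmul (c : k) (x : regular k A) :
    c • x = (c • (show A from x) : A) := by
  change algebraMap k (Env k A) c • x = _
  rw [Algebra.TensorProduct.algebraMap_apply]
  refine (regular_smul (algebraMap k A c) 1 x).trans ?_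
  rw [mul_one, Algebra.smul_def]

/-- The bimodule `A` is the vector space `A`. -/
def regularEquiv (k : Type u) [Field k] (A : Type v) [Ring A] [Algebra k A] :
    regular k A ≃ₗ[k] A where
  toFun x := x
  map_add' _ _ := rfl
  map_smul' c x := regular_ksmul c x
  invFun x := x
  left_inv _ := rfl
  right_inv _ := rfl

theorem regularEquiv_smul (a b : A) (x : regular k A) :
    regularEquiv k A ((a ⊗ₜ[k] op b : Env k A) • x) = a * regularEquiv k A x * b :=
  regular_smul a b x

instance [FiniteDimensional k A] : FiniteDimensional k (regular k A) :=
  Module.Finite.equiv (regularEquiv k A).symm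

/-- A twisted bimodule has the same underlying vector space. -/
def twistEquiv (α β : A ≃ₐ[k] A) (M : ModuleCat.{v} (Env k A)) : twist α β M ≃ₗ[k] M where
  toFun x := x
  map_add' _ _ := rfl
  map_smul' c x := by
    change envMap α β (algebraMap k (Env k A) c) • (show M from x) = _
    rw [AlgEquiv.commutes]
    rfl
  invFun x := x
  left_inv _ := rfl
  right_inv _ := rfl

theorem twistEquiv_smul (α β : A ≃ₐ[k] A) (M : ModuleCat.{v} (Env k A)) (r : Env k A)
    (x : twist α β M) : twistEquiv α β M (r • x) = envMap α β r • twistEquiv α β M x :=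
  rfl

/-- The automorphism μ satisfies μ(a x b) = μ(a) μ(x) μ(b), so it is a μ ⊗ μ-semilinear bijection of
the bimodule `A`. -/
theorem stableRank_regular (α β μ : A ≃ₐ[k] A) (Z : Type*) [AddCommGroup Z] [Module (Env k A) Z]
    [Module k Z] [IsScalarTower k (Env k A) Z] :
    stableRank (envMap α β) (regular k A) Z =
      stableRank (envMap (μ.trans α) (μ.trans β)) (regular k A) Z := by
  let e : regular k A ≃ₗ[k] regular k A :=
    (regularEquiv k A).trans (μ.toLinearEquiv.trans (regularEquiv k A).symm)
  have he : ∀ (r : Env k A) x, e (r • x) = envMap μ μ r • e x := by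
    intro r x
    induction r using env_induction with
    | ht a b =>
      apply (regularEquiv k A).injective
      rw [envMap_tmul, regularEquiv_smul]
      simp [e, regularEquiv_smul]
    | ha r s hr hs => rw [add_smul, map_add, hr, hs, map_add, add_smul]
  rw [stableRank_congr e he (LinearEquiv.refl (Env k A) Z), envMap_trans]

/-! ### The Frobenius form on the enveloping algebra and the duality of dimensions -/

section Frobenius

variable (B : LinearMap.BilinForm k A)

/-- The Frobenius functional `a ⊗ b ↦ B(a, 1) B(b, 1)` on the enveloping algebra. -/
def envFunctional : Env k A →ₗ[k] k :=
  LinearMap.mul' k k ∘ₗ TensorProduct.map (B.flip 1)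
    (B.flip 1 ∘ₗ (opLinearEquiv k : A ≃ₗ[k] Aᵐᵒᵖ).symm.toLinearMap)

@[simp] theorem envFunctional_tmul (a b : A) :
    envFunctional B (a ⊗ₜ[k] op b) = B a 1 * B b 1 := by
  simp [envFunctional]

variable {B}

/-- Nondegeneracy of `B` on both sides writes each coordinate in a tensor product basis as t ↦ l((a
⊗ c) t) for the functional `l`, so an element killed by all of these has no nonzero coordinate. -/
theorem isFrobenius_envFunctional [FiniteDimensional k A] (hB : B.Nondegenerate)
    (hassoc : ∀ a b c : A, B (a * b) c = B a (b * c)) : IsFrobenius (envFunctional B) := by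
  intro s hs
  let b := Module.finBasis k A
  let b' := b.map (opLinearEquiv k : A ≃ₗ[k] Aᵐᵒᵖ)
  have hl : ∀ φ : Module.Dual k A, ∃ a, ∀ x, B a x = φ x := fun φ =>
    ⟨(B.toDual hB).symm φ, LinearMap.BilinForm.apply_toDual_symm_apply φ⟩
  have hr : ∀ φ : Module.Dual k A, ∃ a, ∀ x, B x a = φ x := fun φ =>
    ⟨(B.flip.toDual (LinearMap.BilinForm.nondegenerate_flip_iff.2 hB)).symm φ,
      LinearMap.BilinForm.apply_toDual_symm_apply (B := B.flip) φ⟩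
  apply (b.tensorProduct b').repr.injective
  ext ⟨i, j⟩
  obtain ⟨a, ha⟩ := hl (b.coord i)
  obtain ⟨c, hc⟩ := hr (b.coord j)
  suffices h : ∀ t : Env k A,
      (b.tensorProduct b').repr t (i, j) = envFunctional B ((a ⊗ₜ[k] op c) * t) by
    rw [h, hs, map_zero, Finsupp.zero_apply]
  intro t
  induction t using env_induction with
  | ht x y =>
    rw [Algebra.TensorProduct.tmul_mul_tmul, ← op_mul, envFunctional_tmul, hassoc, mul_one, ha,
      hassoc, mul_one, hc]
    simp [b', mul_comm]
  | ha r s hr hs => rw [map_add, Finsupp.add_apply, hr, hs, mul_add, map_add]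

/-- The Nakayama automorphism of `Aᵉ` is ν ⊗ ν⁻¹, since reversing the multiplication inverts it on
the second factor; its inverse appears here. -/
theorem envFunctional_comm (hassoc : ∀ a b c : A, B (a * b) c = B a (b * c))
    {ν : A ≃ₐ[k] A} (hν : ∀ a b : A, B a b = B b (ν a)) (r s : Env k A) :
    envFunctional B (envMap ν.symm ν r * s) = envFunctional B (s * r) := by
  induction r using env_induction with
  | ht a b =>
    induction s using env_induction with
    | ht c d =>
      have h1 : B (ν.symm a) c = B c a := by rw [hν, AlgEquiv.apply_symm_apply]
      simp only [envMap_tmul, Algebra.TensorProduct.tmul_mul_tmul, ← op_mul, envFunctional_tmul,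
        hassoc, mul_one, h1, ← hν b d]
    | ha r s hr hs => rw [mul_add, add_mul, map_add, map_add, hr, hs]
  | ha r s hr hs => rw [map_add, mul_add, add_mul, map_add, map_add, hr, hs]

/-- The dual of `X ⊗_{Aᵉ} A` is the space of maps from `X` to a twist of `A`. -/
theorem exists_tensorEnv_dual [FiniteDimensional k A] (hB : B.Nondegenerate)
    (hassoc : ∀ a b c : A, B (a * b) c = B a (b * c))
    {ν : A ≃ₐ[k] A} (hν : ∀ a b : A, B a b = B b (ν a)) (X : ModuleCat.{v} (Env k A)) :
    ∃ Ψ : semilinearHom (envMap ν.symm 1) X (regular k A) ≃ₗ[k]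
        Module.Dual k ((tensorEnv (regular k A)).obj X),
      ∀ g (x : X) (m : regular k A),
        Ψ g (Submodule.Quotient.mk (p := balanced X (regular k A)) (x ⊗ₜ[k] m)) =
          B (regularEquiv k A ((g : X →ₗ[k] regular k A) x)) (regularEquiv k A m) := by
  let e := regularEquiv k A
  let B' : regular k A →ₗ[k] regular k A →ₗ[k] k := B.compl₁₂ e.toLinearMap e.toLinearMap
  have hB' : ∀ x y, B' x y = B (e x) (e y) := fun _ _ => rfl
  -- B(ν⁻¹(b) x a, y) = B(x a y, b) = B(x, a y b): moving `b` cyclically around the form costs one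
  -- ν, which explains the twist on the left only.
  have key : ∀ (a b : A) (x y : regular k A),
      B' (envMap ν.symm 1 (b ⊗ₜ[k] op a) • x) y = B' x ((a ⊗ₜ[k] op b : Env k A) • y) := by
    intro a b x y
    rw [hB', hB', envMap_tmul, regularEquiv_smul, regularEquiv_smul, mul_assoc, hassoc, hν,
      AlgEquiv.apply_symm_apply, hassoc, hassoc, mul_assoc]
    rfl
  let Φ : semilinearHom (envMap ν.symm 1) X (regular k A) →ₗ[k]
      Module.Dual k ((X ⊗[k] regular k A) ⧸ balanced X (regular k A)) :=
    { toFun := fun g => (balanced X (regular k A)).liftQ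
        (TensorProduct.lift (B' ∘ₗ (g : X →ₗ[k] regular k A))) (by
          rw [balanced, Submodule.span_le]
          rintro _ ⟨a, b, x, m, rfl⟩
          rw [SetLike.mem_coe, LinearMap.mem_ker, map_sub, TensorProduct.lift.tmul,
            TensorProduct.lift.tmul, LinearMap.comp_apply, LinearMap.comp_apply, g.2, key,
            sub_self])
      map_add' := fun g g' => by
        refine Submodule.linearMap_qext _ (TensorProduct.ext' fun x m => ?_)
        simp
      map_smul' := fun c g => by
        refine Submodule.linearMap_qext _ (TensorProduct.ext' fun x m => ?_)
        simp }
  have hΦ : ∀ g (x : X) (m : regular k A),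
      Φ g (Submodule.Quotient.mk (p := balanced X (regular k A)) (x ⊗ₜ[k] m)) =
        B' ((g : X →ₗ[k] regular k A) x) m := fun g x m => rfl
  have sep : ∀ x y : regular k A, (∀ m, B' x m = B' y m) → x = y := fun x y h => by
    rw [← sub_eq_zero, ← e.map_eq_zero_iff]
    refine hB.1 _ fun m => ?_
    obtain ⟨m, rfl⟩ := e.surjective m
    rw [← hB', map_sub, LinearMap.sub_apply, h, sub_self]
  have bij : Function.Bijective Φ := by
    constructor
    · intro g g' h
      ext x
      exact sep _ _ fun m => by rw [← hΦ, h, hΦ]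
    · intro φ
      let ψ : X →ₗ[k] regular k A := e.symm.toLinearMap ∘ₗ (B.toDual hB).symm.toLinearMap ∘ₗ
        (LinearMap.lcomp k k e.symm.toLinearMap) ∘ₗ
          TensorProduct.curry (φ ∘ₗ (balanced X (regular k A)).mkQ)
      have hψ : ∀ x m, B' (ψ x) m =
          φ (Submodule.Quotient.mk (p := balanced X (regular k A)) (x ⊗ₜ[k] m)) := by
        intro x m
        rw [hB']
        simp only [ψ, LinearMap.comp_apply, LinearEquiv.coe_coe, LinearEquiv.apply_symm_apply,
          LinearMap.BilinForm.apply_toDual_symm_apply]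
        simp
      refine ⟨⟨ψ, fun r x => ?_⟩, ?_⟩
      · induction r using env_induction with
        | ht b a =>
          refine sep _ _ fun m => ?_
          rw [key, hψ, hψ]
          congr 1
          rw [Submodule.Quotient.eq]
          exact Submodule.subset_span ⟨a, b, x, m, rfl⟩
        | ha r s hr hs => rw [add_smul, map_add, hr, hs, map_add, add_smul]
      · refine Submodule.linearMap_qext _ (TensorProduct.ext' fun x m => ?_)
        exact hψ x m
  exact ⟨LinearEquiv.ofBijective Φ bij, fun g x m => rfl⟩

theorem finrank_range_tensorEnv_map [FiniteDimensional k A] (hB : B.Nondegenerate)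
    (hassoc : ∀ a b c : A, B (a * b) c = B a (b * c))
    {ν : A ≃ₐ[k] A} (hν : ∀ a b : A, B a b = B b (ν a)) {X Y : ModuleCat.{v} (Env k A)}
    (f : X ⟶ Y) :
    Module.finrank k (LinearMap.range ((tensorEnv (regular k A)).map f).hom) =
      Module.finrank k
        (LinearMap.range (precomp (envMap ν.symm 1) f.hom (regular k A))) := by
  obtain ⟨Ψ, hΨ⟩ := exists_tensorEnv_dual hB hassoc hν X
  obtain ⟨Ψ', hΨ'⟩ := exists_tensorEnv_dual hB hassoc hν Y
  rw [← LinearMap.finrank_range_dualMap_eq_finrank_range]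
  refine (finrank_range_eq_of_comm _ _ Ψ' Ψ fun g => ?_).symm
  refine Submodule.linearMap_qext _ (TensorProduct.ext' fun x m => ?_)
  exact (hΨ _ x m).trans (hΨ' g (f.hom x) m).symm

instance [FiniteDimensional k A] (X M : ModuleCat.{v} (Env k A)) [FiniteDimensional k X]
    [FiniteDimensional k M] : FiniteDimensional k ((tensorEnv M).obj X) :=
  inferInstanceAs (FiniteDimensional k ((X ⊗[k] M) ⧸ balanced X M))

theorem finrank_homology_regular [FiniteDimensional k A] (hB : B.Nondegenerate)
    (hassoc : ∀ a b c : A, B (a * b) c = B a (b * c))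
    {ν : A ≃ₐ[k] A} (hν : ∀ a b : A, B a b = B b (ν a))
    (T : CompleteResolution k (regular k A)) (n : ℤ) :
    FiniteDimensional k (homology T (regular k A) (n + 1)) ∧
      (Module.finrank k (homology T (regular k A) (n + 1)) : ℤ) =
        Module.finrank k (semilinearHom (envMap ν.symm 1) (T.T.X (n + 1)) (regular k A)) -
          Module.finrank k (LinearMap.range
            (precomp (envMap ν.symm 1) (T.T.d (n + 1) n).hom (regular k A))) -
          Module.finrank k (LinearMap.range
            (precomp (envMap ν.symm 1) (T.T.d (n + 1 + 1) (n + 1)).hom (regular k A))) := by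
  have := T.finiteDimensional_T
  let K := ((tensorEnv (regular k A)).mapHomologicalComplex (ComplexShape.down ℤ)).obj T.T
  have hK : FiniteDimensional k (K.X (n + 1)) :=
    inferInstanceAs (FiniteDimensional k ((tensorEnv (regular k A)).obj (T.T.X (n + 1))))
  obtain ⟨h1, h2⟩ := finrank_homology K (i := n + 1 + 1) (j := n + 1) (l := n) (by simp) (by simp)
  refine ⟨h1, ?_⟩
  obtain ⟨Ψ, -⟩ := exists_tensorEnv_dual hB hassoc hν (T.T.X (n + 1))
  -- Dualizing exchanges incoming and outgoing differentials, so the two subtracted ranks are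
  -- swapped.
  rw [Ψ.finrank_eq, Subspace.dual_finrank_eq, ← finrank_range_tensorEnv_map hB hassoc hν,
    ← finrank_range_tensorEnv_map hB hassoc hν, sub_right_comm]
  exact h2

theorem finrank_homology_duality [FiniteDimensional k A] (hB : B.Nondegenerate)
    (hassoc : ∀ a b c : A, B (a * b) c = B a (b * c))
    {ν : A ≃ₐ[k] A} (hν : ∀ a b : A, B a b = B b (ν a))
    (T T' : CompleteResolution k (regular k A)) {i j : ℤ} (hij : i + j = -3) :
    Module.finrank k (homology T (regular k A) (i + 1)) =
      Module.finrank k (homology T' (regular k A) (j + 1)) := by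
  have hl := isFrobenius_envFunctional hB hassoc
  have := T.finiteDimensional_T
  have := T'.finiteDimensional_T
  -- The Nakayama partner of τ = ν⁻¹ ⊗ 1 is ρ = 1 ⊗ ν.
  have hρ : ∀ r s, envFunctional B (envMap 1 ν (envMap ν.symm 1 r) * s) =
      envFunctional B (s * r) := fun r s => by
    rw [← AlgEquiv.trans_apply, envMap_trans]
    exact envFunctional_comm hassoc hν r s
  have h1 := (finrank_homology_regular hB hassoc hν T i).2
  have h2 := (finrank_homology_regular hB hassoc hν T' j).2
  -- For `T` the first description is used and moved to maps out of `A`; the diagonal twist by ν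
  -- turns ν⁻¹ ⊗ 1 into 1 ⊗ ν. For `T'` the second description gives the same stable rank directly.
  rw [hl.finrank_precomp _ (T.hasDualBasis_T i) (T.exact i),
    T.stableRank_balance hl _ T' i (j + 1) (by lia), stableRank_regular _ _ ν] at h1
  rw [hl.finrank_precomp_eq_stableRank hρ (T'.hasDualBasis_T _) (T'.hasDualBasis_T _)
    (T'.hasDualBasis_T _) (T'.exact j)] at h2
  have h3 : (envMap (ν.trans ν.symm) (ν.trans 1) : Env k A ≃ₐ[k] Env k A) = envMap 1 ν :=
    env_algEquiv_ext fun a b => by simp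
  rw [h3, ← h2] at h1
  exact_mod_cast h1

theorem finrank_cohomology_duality [FiniteDimensional k A] (hB : B.Nondegenerate)
    (hassoc : ∀ a b c : A, B (a * b) c = B a (b * c))
    {ν : A ≃ₐ[k] A} (hν : ∀ a b : A, B a b = B b (ν a))
    (T T' : CompleteResolution k (regular k A)) {i j : ℤ} (hij : i + j = -3) :
    FiniteDimensional k (cohomology T (regular k A) (i + 1)) ∧
    FiniteDimensional k (cohomology T' (twist 1 (ν ^ 2) (regular k A)) (j + 1)) ∧
    Module.finrank k (cohomology T (regular k A) (i + 1)) =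
      Module.finrank k (cohomology T' (twist 1 (ν ^ 2) (regular k A)) (j + 1)) := by
  have hl := isFrobenius_envFunctional hB hassoc
  have := T.finiteDimensional_T
  have := T'.finiteDimensional_T
  -- Here the partner ν⁻¹ ⊗ ν⁻¹ is diagonal, so it may be compared with the untwisted maps computing
  -- the cohomology of `T`.
  have hρ : ∀ r s, envFunctional B (envMap ν.symm ν.symm (envMap 1 (ν ^ 2) r) * s) =
      envFunctional B (s * r) := fun r s => by
    have h : (ν ^ 2).trans ν.symm = ν := AlgEquiv.ext fun a => by simp [pow_two]
    rw [← AlgEquiv.trans_apply, envMap_trans, h]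
    exact envFunctional_comm hassoc hν r s
  obtain ⟨h1, h2⟩ := finrank_linearYonedaObj_homology T.T T.finiteDimensional_T
    (N := regular k A) (τ := envMap 1 1) (LinearEquiv.refl k (regular k A))
    (fun r x => by rw [envMap_one_one]; rfl) i
  obtain ⟨h3, h4⟩ := finrank_linearYonedaObj_homology T'.T T'.finiteDimensional_T
    (twistEquiv 1 (ν ^ 2) (regular k A)) (twistEquiv_smul 1 (ν ^ 2) (regular k A)) j
  refine ⟨h1, h3, ?_⟩
  rw [hl.finrank_precomp _ (T.hasDualBasis_T i) (T.exact i),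
    T.stableRank_balance hl _ T' i (j + 1) (by lia), stableRank_regular _ _ ν.symm] at h2
  rw [hl.finrank_precomp_eq_stableRank hρ (T'.hasDualBasis_T _) (T'.hasDualBasis_T _)
    (T'.hasDualBasis_T _) (T'.exact j)] at h4
  exact_mod_cast h2.trans h4.symm

end Frobenius

end Enveloping

end TateHochschild

namespace TateHochschild

/-! ### Existence of complete resolutions over a Frobenius algebra -/

section Existence

variable {k : Type u} [Field k] {R : Type v} [Ring R] [Algebra k R]

theorem finiteDimensional_of_finite [FiniteDimensional k R] (X : ModuleCat.{v} R)
    [Module.Finite R X] : FiniteDimensional k X :=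
  Module.Finite.trans R X

/-- A short exact sequence `0 ⟶ K ⟶ F ⟶ X ⟶ 0` with `F` finitely generated projective. -/
structure SyzygySequence (K X : ModuleCat.{v} R) where
  /-- the middle term -/
  F : ModuleCat.{v} R
  finite : Module.Finite R F
  projective : Module.Projective R F
  /-- the inclusion -/
  i : K ⟶ F
  /-- the projection -/
  p : F ⟶ X
  injective : Function.Injective i.hom
  surjective : Function.Surjective p.hom
  exact : Function.Exact i.hom p.hom

theorem exists_syzygySequence [FiniteDimensional k R] (X : ModuleCat.{v} R)
    [FiniteDimensional k X] :
    ∃ K : ModuleCat.{v} R, FiniteDimensional k K ∧ Nonempty (SyzygySequence K X) := by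
  have : Module.Finite R X := Module.Finite.of_restrictScalars_finite k R X
  obtain ⟨n, f, hf⟩ := Module.Finite.exists_fin' R X
  have : FiniteDimensional k (LinearMap.ker f) :=
    Module.Finite.of_injective ((LinearMap.ker f).subtype.restrictScalars k)
      (Submodule.injective_subtype _)
  have hK : Module.Finite R (ModuleCat.of R (LinearMap.ker f)) :=
    Module.Finite.of_restrictScalars_finite k R (LinearMap.ker f)
  refine ⟨ModuleCat.of R (LinearMap.ker f), finiteDimensional_of_finite _, ⟨
    { F := ModuleCat.of R (Fin n → R)
      finite := inferInstanceAs (Module.Finite R (Fin n → R))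
      projective := inferInstanceAs (Module.Projective R (Fin n → R))
      i := ModuleCat.ofHom (LinearMap.ker f).subtype
      p := ModuleCat.ofHom f
      injective := Submodule.injective_subtype _
      surjective := hf
      exact := LinearMap.exact_subtype_ker_map f }⟩⟩

/-- The `R`-linear lifts of the coordinate functionals through the Frobenius functional jointly
embed `X` in a free module of rank dim `X`. -/
theorem IsFrobenius.exists_cosyzygySequence [FiniteDimensional k R] {l : R →ₗ[k] k}
    (hl : IsFrobenius l) (X : ModuleCat.{v} R) [FiniteDimensional k X] :
    ∃ C : ModuleCat.{v} R, FiniteDimensional k C ∧ Nonempty (SyzygySequence X C) := by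
  let b := Module.finBasis k X
  choose f hf using fun j => hl.exists_linearMap (b.coord j)
  let g : X →ₗ[R] (Fin (Module.finrank k X) → R) := LinearMap.pi f
  have hg : Function.Injective g := by
    rw [injective_iff_map_eq_zero]
    intro x hx
    refine b.forall_coord_eq_zero_iff.1 fun j => ?_
    rw [← hf, show f j x = 0 from congrFun hx j, map_zero]
  have hC : Module.Finite R (ModuleCat.of R ((Fin (Module.finrank k X) → R) ⧸ LinearMap.range g)) :=
    inferInstanceAs (Module.Finite R ((Fin (Module.finrank k X) → R) ⧸ LinearMap.range g))
  refine ⟨ModuleCat.of R ((Fin (Module.finrank k X) → R) ⧸ LinearMap.range g),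
    finiteDimensional_of_finite _, ⟨
    { F := ModuleCat.of R (Fin (Module.finrank k X) → R)
      finite := inferInstanceAs (Module.Finite R (Fin (Module.finrank k X) → R))
      projective := inferInstanceAs (Module.Projective R (Fin (Module.finrank k X) → R))
      i := ModuleCat.ofHom g
      p := ModuleCat.ofHom (LinearMap.range g).mkQ
      injective := hg
      surjective := Submodule.mkQ_surjective _
      exact := LinearMap.exact_map_mkQ_range g }⟩⟩

/-- Syzygies and cosyzygies of a module over a Frobenius algebra fit into a two-sided sequence. -/
theorem IsFrobenius.exists_syzygySequences [FiniteDimensional k R] {l : R →ₗ[k] k}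
    (hl : IsFrobenius l) (X : ModuleCat.{v} R) [FiniteDimensional k X] :
    ∃ Z : ℤ → ModuleCat.{v} R, Z 0 = X ∧ Nonempty (∀ n, SyzygySequence (Z (n + 1)) (Z n)) := by
  let FD := {X : ModuleCat.{v} R // FiniteDimensional k X}
  have h1 : ∀ X : FD, ∃ K : FD, Nonempty (SyzygySequence K.1 X.1) := fun X =>
    have := X.2
    let ⟨K, hK, h⟩ := exists_syzygySequence (k := k) X.1
    ⟨⟨K, hK⟩, h⟩
  have h2 : ∀ X : FD, ∃ C : FD, Nonempty (SyzygySequence X.1 C.1) := fun X =>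
    have := X.2
    let ⟨K, hK, h⟩ := hl.exists_cosyzygySequence X.1
    ⟨⟨K, hK⟩, h⟩
  choose Ω hΩ using h1
  choose C hC using h2
  let z : ℕ → FD := fun n => Ω^[n] ⟨X, inferInstance⟩
  let w : ℕ → FD := fun n => C^[n] ⟨X, inferInstance⟩
  have hz : ∀ n, z (n + 1) = Ω (z n) := fun n => Function.iterate_succ_apply' _ _ _
  have hw : ∀ n, w (n + 1) = C (w n) := fun n => Function.iterate_succ_apply' _ _ _
  refine ⟨fun n => Int.casesOn n (fun n => (z n).1) (fun n => (w (n + 1)).1), rfl,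
    ⟨fun n => Classical.choice ?_⟩⟩
  -- The case of index -1 is the junction, where the first cosyzygy sequence starts from `X` itself.
  rcases n with n | _ | n
  · change Nonempty (SyzygySequence (z (n + 1)).1 (z n).1)
    rw [hz]
    exact hΩ _
  · exact hC _
  · change Nonempty (SyzygySequence (w (n + 1)).1 (w (n + 1 + 1)).1)
    rw [hw (n + 1)]
    exact hC _

variable {Z : ℤ → ModuleCat.{v} R} (E : ∀ n, SyzygySequence (Z (n + 1)) (Z n))

theorem exists_factor {X Y W : Type*} [AddCommGroup X] [Module R X] [AddCommGroup Y] [Module R Y]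
    [AddCommGroup W] [Module R W] {p : X →ₗ[R] Y} (hp : Function.Surjective p) {f : X →ₗ[R] W}
    (h : LinearMap.ker p ≤ LinearMap.ker f) : ∃ g : Y →ₗ[R] W, g ∘ₗ p = f := by
  let q := p.quotKerEquivOfSurjective hp
  refine ⟨(LinearMap.ker p).liftQ f h ∘ₗ q.symm.toLinearMap, LinearMap.ext fun x => ?_⟩
  have h2 : q.symm (p x) = Submodule.Quotient.mk x := by
    rw [LinearEquiv.symm_apply_eq]
    rfl
  rw [LinearMap.comp_apply, LinearMap.comp_apply, LinearEquiv.coe_coe, h2]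
  rfl

namespace SyzygySequence

theorem i_comp_p {K X : ModuleCat.{v} R} (S : SyzygySequence K X) : S.i ≫ S.p = 0 := by
  ext x
  exact S.exact.apply_apply_eq_zero x

/-- Splicing of two syzygy sequences is exact. -/
theorem exact_splice {X₀ X₁ X₂ X₃ : ModuleCat.{v} R} (S₂ : SyzygySequence X₃ X₂)
    (S₁ : SyzygySequence X₂ X₁) (S₀ : SyzygySequence X₁ X₀) :
    Function.Exact (S₂.p ≫ S₁.i).hom (S₁.p ≫ S₀.i).hom := fun x => by
  simp only [ModuleCat.hom_comp, LinearMap.comp_apply, Set.mem_range]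
  rw [map_eq_zero_iff _ S₀.injective, S₁.exact x]
  constructor
  · rintro ⟨y, rfl⟩
    obtain ⟨y, rfl⟩ := S₂.surjective y
    exact ⟨y, rfl⟩
  · rintro ⟨y, rfl⟩
    exact ⟨_, rfl⟩

/-- The complex obtained by splicing a two-sided sequence of syzygy sequences. -/
noncomputable def complex : ChainComplex (ModuleCat.{v} R) ℤ :=
  ChainComplex.of (fun n => (E n).F) (fun n => (E (n + 1)).p ≫ (E n).i) fun n => by
    rw [Category.assoc, ← Category.assoc (E (n + 1)).i, i_comp_p, Limits.zero_comp,
      Limits.comp_zero]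

theorem complex_d (n : ℤ) : (complex E).d (n + 1) n = (E (n + 1)).p ≫ (E n).i :=
  ChainComplex.of_d (fun n => (E n).F) (fun n => (E (n + 1)).p ≫ (E n).i) n

/-- The splicing differential in non-negative degrees. -/
def natDifferential (n : ℕ) : (E (n + 1 : ℕ)).F ⟶ (E n).F :=
  (E (n + 1 : ℤ)).p ≫ (E n).i

/-- The complex obtained by splicing the syzygy sequences in non-negative degrees. -/
noncomputable def natComplex : ChainComplex (ModuleCat.{v} R) ℕ :=
  ChainComplex.of (fun n => (E n).F) (natDifferential E) fun n => by
    change ((E (n + 1 + 1 : ℤ)).p ≫ (E (n + 1 : ℤ)).i) ≫ (E (n + 1 : ℤ)).p ≫ (E n).i = 0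
    rw [Category.assoc, ← Category.assoc (E (n + 1)).i, i_comp_p, Limits.zero_comp,
      Limits.comp_zero]

theorem natComplex_d (n : ℕ) :
    (natComplex E).d (n + 1) n = (E (n + 1 : ℤ)).p ≫ (E n).i :=
  ChainComplex.of_d (fun n : ℕ => (E n).F) (natDifferential E) n

theorem natComplex_exactAt_succ (n : ℕ) : (natComplex E).ExactAt (n + 1) := by
  rw [HomologicalComplex.exactAt_iff' _ (n + 1 + 1) (n + 1) n (by simp) (by simp),
    ShortComplex.ShortExact.moduleCat_exact_iff_function_exact]
  change Function.Exact ((natComplex E).d (n + 1 + 1) (n + 1)).hom ((natComplex E).d (n + 1) n).hom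
  rw [natComplex_d, natComplex_d]
  exact exact_splice (E (n + 1 + 1 : ℤ)) (E (n + 1 : ℤ)) (E n)

/-- The projective resolution obtained by splicing the syzygy sequences in non-negative degrees. -/
noncomputable def projectiveResolution : ProjectiveResolution (Z 0) where
  complex := natComplex E
  projective n := by
    have : Module.Projective R ((natComplex E).X n) := (E n).projective
    exact (IsProjective.iff_projective _).1 this
  π := (ChainComplex.toSingle₀Equiv _ _).symm ⟨(E 0).p, by
    rw [show (natComplex E).d 1 0 = _ from natComplex_d E 0]
    refine (Category.assoc (E 1).p (E 0).i (E 0).p).trans ?_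
    exact (congrArg _ (E 0).i_comp_p).trans Limits.comp_zero⟩
  quasiIso := ⟨fun n => by
    cases n
    · rw [ChainComplex.quasiIsoAt₀_iff, ShortComplex.quasiIso_iff_of_zeros']
      · constructor
        · rw [ShortComplex.ShortExact.moduleCat_exact_iff_function_exact]
          change Function.Exact ((natComplex E).d 1 0).hom (E 0).p.hom
          rw [show (natComplex E).d 1 0 = _ from natComplex_d E 0]
          intro x
          rw [(E 0).exact x]
          constructor
          · rintro ⟨y, rfl⟩
            obtain ⟨y, rfl⟩ := (E (0 + 1)).surjective y
            exact ⟨y, rfl⟩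
          · rintro ⟨y, rfl⟩
            exact ⟨_, rfl⟩
        · exact (ModuleCat.epi_iff_surjective (E 0).p).2 (E 0).surjective
      all_goals rfl
    · rw [quasiIsoAt_iff_exactAt']
      · apply natComplex_exactAt_succ
      · apply ChainComplex.exactAt_succ_single_obj⟩

theorem complex_acyclic : (complex E).Acyclic := by
  intro m
  obtain ⟨n, rfl⟩ : ∃ n, m = n + 1 := ⟨m - 1, by ring⟩
  rw [HomologicalComplex.exactAt_iff' _ (n + 1 + 1) (n + 1) n (by simp) (by simp),
    ShortComplex.ShortExact.moduleCat_exact_iff_function_exact]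
  change Function.Exact ((complex E).d (n + 1 + 1) (n + 1)).hom ((complex E).d (n + 1) n).hom
  rw [complex_d, complex_d]
  exact exact_splice _ _ _

/-- A cocycle on `F (n + 1)` descends to the syzygy `Z (n + 1)`, and self-injectivity extends it
from there to `F n`. -/
theorem complex_dual_acyclic [FiniteDimensional k R] {l : R →ₗ[k] k} (hl : IsFrobenius l) :
    ((complex E).linearYonedaObj k (ModuleCat.of R R)).Acyclic := by
  intro m
  obtain ⟨n, rfl⟩ : ∃ n, m = n + 1 := ⟨m - 1, by ring⟩
  rw [HomologicalComplex.exactAt_iff' _ n (n + 1) (n + 1 + 1) (by simp) (by simp),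
    ShortComplex.moduleCat_exact_iff]
  intro (f : (E (n + 1)).F ⟶ ModuleCat.of R R) (hf : (complex E).d (n + 1 + 1) (n + 1) ≫ f = 0)
  rw [complex_d] at hf
  have h0 : ∀ x, f.hom ((E (n + 1)).i.hom x) = 0 := fun x => by
    obtain ⟨y, rfl⟩ := (E (n + 1 + 1)).surjective x
    exact LinearMap.congr_fun (congrArg ModuleCat.Hom.hom hf) y
  have hker : LinearMap.ker (E (n + 1)).p.hom ≤ LinearMap.ker f.hom := fun x hx => by
    obtain ⟨y, rfl⟩ := ((E (n + 1)).exact x).1 hx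
    exact h0 y
  obtain ⟨g, hg⟩ := exists_factor (E (n + 1)).surjective hker
  obtain ⟨h, rfl⟩ := hl.exists_extend (E n).injective g
  refine ⟨(ModuleCat.ofHom h : (E n).F ⟶ ModuleCat.of R R), ?_⟩
  change (complex E).d (n + 1) n ≫ ModuleCat.ofHom h = f
  rw [complex_d]
  exact ModuleCat.hom_ext hg

end SyzygySequence

open SyzygySequence in
theorem IsFrobenius.nonempty_completeResolution [FiniteDimensional k R] {l : R →ₗ[k] k}
    (hl : IsFrobenius l) (X : ModuleCat.{v} R) [FiniteDimensional k X] :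
    Nonempty (CompleteResolution k X) := by
  obtain ⟨Z, rfl, ⟨E⟩⟩ := hl.exists_syzygySequences X
  exact ⟨
    { T := complex E
      finite_T := fun n => (E n).finite
      projective_T := fun n => (E n).projective
      acyclic := complex_acyclic E
      dual_acyclic := complex_dual_acyclic E hl
      P := projectiveResolution E
      finite_P := fun n => (E n).finite
      θ := fun n => 𝟙 ((E n).F)
      comm := fun n => by
        refine (Category.id_comp _).trans (Eq.trans ?_ (Category.comp_id _).symm)
        exact (natComplex_d E n).trans (complex_d E n).symm
      isIso_θ := ⟨0, fun n _ => inferInstanceAs (IsIso (𝟙 ((E n).F)))⟩ }⟩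

end Existence

end TateHochschild

/-! ### The main theorem -/

theorem corollary4p4 {k : Type u} [Field k] {A : Type v} [Ring A] [Algebra k A]
    [FiniteDimensional k A]
    (B : LinearMap.BilinForm k A) (hB : B.Nondegenerate)
    (hassoc : ∀ a b c : A, B (a * b) c = B a (b * c))
    (ν : A ≃ₐ[k] A) (hν : ∀ a b : A, B a b = B b (ν a)) :
    Nonempty (TateHochschild.CompleteResolution k (TateHochschild.regular k A)) ∧
    ∀ (T T' : TateHochschild.CompleteResolution k (TateHochschild.regular k A)) (i : ℤ),
      Nonempty (TateHochschild.homology T (TateHochschild.regular k A) i ≃ₗ[k]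
        Module.Dual k (TateHochschild.homology T' (TateHochschild.regular k A) (-i - 1))) ∧
      Nonempty (TateHochschild.cohomology T (TateHochschild.regular k A) i ≃ₗ[k]
        Module.Dual k (TateHochschild.cohomology T'
          (TateHochschild.twist 1 (ν ^ 2) (TateHochschild.regular k A)) (-i - 1))) := by
  refine ⟨(TateHochschild.isFrobenius_envFunctional hB hassoc).nonempty_completeResolution _,
    fun T T' n => ?_⟩
  -- Degrees are written `i + 1` and `j + 1` to match the dimension formulas; their sum -1 becomes i
  -- + j = -3.
  obtain ⟨i, rfl⟩ : ∃ i, n = i + 1 := ⟨n - 1, by ring⟩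
  obtain ⟨j, hj⟩ : ∃ j, -(i + 1) - 1 = j + 1 := ⟨-(i + 1) - 1 - 1, by ring⟩
  rw [hj]
  have hij : i + j = -3 := by lia
  obtain ⟨h1, h2, h3⟩ := TateHochschild.finrank_cohomology_duality hB hassoc hν T T' hij
  have h4 := (TateHochschild.finrank_homology_regular hB hassoc hν T i).1
  have h5 := (TateHochschild.finrank_homology_regular hB hassoc hν T' j).1
  constructor
  · refine FiniteDimensional.nonempty_linearEquiv_of_finrank_eq ?_
    rw [Subspace.dual_finrank_eq, TateHochschild.finrank_homology_duality hB hassoc hν T T' hij]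
  · refine FiniteDimensional.nonempty_linearEquiv_of_finrank_eq ?_
    rw [Subspace.dual_finrank_eq, h3]
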